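/- **The Tool Loading Problem (TLP).** An instance consists of $n$ jobs $1,\dots,n$, $m$ tools $1,\dots,m$, a magazine capacity $C<m$ and tool sets $T_1,\dots,T_n$ with $\bigcup_{i=1}^n T_i=\{1,\dots,m\}$ and $|T_i|\le C$ for all $i$. A feasible solution is a sequence $M=(M_1,\dots,M_n)$ of magazine states with $T_i\subseteq M_i\subseteq\{1,\dots,m\}$ and $|M_i|=C$ for all $i$; its number of switches is $\mathrm{switches}(M)=\sum_{i=1}^{n-1}|M_{i+1}\setminus M_i|$. The TLP asks for the least number of switches and for a feasible $M$ that attains it. **Algorithm.** The program below works on integer registers and arrays, and uses only additions, subtractions, comparisons, assignments and array accesses, each of which takes one unit of time. The input is $n$, $m$, $C$, the numbers $|T_1|,\dots,|T_n|$, and an array that lists the elements of $T_1,\dots,T_n$ one set after the other, each set in any order. *GPCA.* Put $pipes\_count:=0$, $last\_full:=0$; $last\_seen[t]:=1$ for $t\in T_1$ and $last\_seen[t]:=-1$ for all other tools; $M_i:=T_i$ for all $i$. For $e=2,\dots,n$: for every $t\in T_e$, if $last\_full\le last\_seen[t]$, then increase $pipes\_count$ by $1$ and, for $i=last\_seen[t]+1,\dots,e-1$,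 add $t$ to $M_i$ and put $last\_full:=i$ if now $|M_i|=C$; in either case put $last\_seen[t]:=e$. After all $t\in T_e$ are done, put $last\_full:=e$ if $|M_e|=C$. At the end return the value $\sum_{i=1}^n|T_i|-C-pipes\_count$. *ToFullMag.* For $(i,j)=(1,2),(2,3),\dots,(n-1,n),(n,n-1),\dots,(2,1)$ in this order: add tools of $M_i\setminus M_j$ to $M_j$ one at a time, as long as $|M_j|<C$ and there are any (membership in $M_j$ is tested by an array of marks $used[t]$, which is set at the beginning and cleared at the end of each step). **Theorem.** There is an absolute constant $K$ such that on every instance of the TLP the program that runs GPCA and then ToFullMag halts after at most $K\cdot C\cdot n$ units of time, and then the returned value is $\min\{\mathrm{switches}(M): M\text{ feasible}\}$ and the stored sequence $(M_1,\dots,M_n)$ is a feasible solution that attains this minimum. Thus the TLP, both its optimal value and an optimal magazine sequence, is solved in $O(Cn)$ time. -/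

import Mathlib

namespace TLP

/-! ### The Tool Loading Problem

Jobs are numbered `1, …, n` and tools `1, …, m`; job `i` needs the tools in `T i`, and the magazine
has `C` slots. Values of `T` and `M` outside `1, …, n` play no role. -/

/-- The data of a Tool Loading Problem: every tool `1, …, m` is needed by some job, every job fits
into the magazine, and the magazine cannot hold all tools. -/
structure IsInstance (n m C : ℕ) (T : ℕ → Finset ℕ) : Prop where
  union_eq : (Finset.Icc 1 n).biUnion T = Finset.Icc 1 m
  card_le : ∀ i ∈ Finset.Icc 1 n, (T i).card ≤ C
  lt : C < m

/-- `M 1, …, M n` is a sequence of (full) magazine states that allows the jobs to be processed in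
the order `1, …, n`. -/
def Feasible (n m C : ℕ) (T M : ℕ → Finset ℕ) : Prop :=
  ∀ i ∈ Finset.Icc 1 n, T i ⊆ M i ∧ M i ⊆ Finset.Icc 1 m ∧ (M i).card = C

/-- The number of tool switches `|M₂ \ M₁| + |M₃ \ M₂| + ⋯ + |Mₙ \ Mₙ₋₁|`. -/
def switches (n : ℕ) (M : ℕ → Finset ℕ) : ℕ :=
  ∑ i ∈ Finset.Ico 1 n, (M (i + 1) \ M i).card

/-- `M` is an optimal solution: a feasible sequence with the least number of switches. -/
def Optimal (n m C : ℕ) (T M : ℕ → Finset ℕ) : Prop :=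
  Feasible n m C T M ∧ IsMinOn (switches n) {M' | Feasible n m C T M'} M

/-! ### Random access machine programs and their running time

A machine has integer registers (with names in `R`) and integer arrays (with names in `A`) that are
accessed by computed addresses. The only arithmetic operations are addition and subtraction.
Every access to a constant, a register or an array cell, every arithmetic operation, every
comparison, every assignment and every no-operation takes one unit of time. -/

/-- Memory contents. -/
structure State (R A : Type) where
  reg : R → ℤ
  arr : A → ℤ → ℤ

/-- Arithmetic expressions. -/
inductive Expr (R A : Type) where
  | const (z : ℤ)
  | reg (r : R)
  | cell (a : A) (index : Expr R A)
  | add (x y : Expr R A)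
  | sub (x y : Expr R A)

/-- Comparisons. -/
inductive Cond (R A : Type) where
  | le (x y : Expr R A)
  | lt (x y : Expr R A)
  | eq (x y : Expr R A)

/-- Programs. -/
inductive Stmt (R A : Type) where
  | skip
  | assign (r : R) (x : Expr R A)
  | store (a : A) (index x : Expr R A)
  | seq (s s' : Stmt R A)
  | branch (c : Cond R A) (s s' : Stmt R A)
  | loop (c : Cond R A) (s : Stmt R A)

section Semantics

variable {R A : Type}

/-- The value of an expression. -/
def Expr.eval (σ : State R A) : Expr R A → ℤ
  | .const z => z
  | .reg r => σ.reg r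
  | .cell a x => σ.arr a (x.eval σ)
  | .add x y => x.eval σ + y.eval σ
  | .sub x y => x.eval σ - y.eval σ

/-- The time it takes to evaluate an expression. -/
def Expr.cost : Expr R A → ℕ
  | .const _ => 1
  | .reg _ => 1
  | .cell _ x => x.cost + 1
  | .add x y => x.cost + y.cost + 1
  | .sub x y => x.cost + y.cost + 1

/-- The truth value of a comparison. -/
def Cond.Holds (σ : State R A) : Cond R A → Prop
  | .le x y => x.eval σ ≤ y.eval σ
  | .lt x y => x.eval σ < y.eval σ
  | .eq x y => x.eval σ = y.eval σ

/-- The time it takes to evaluate a comparison. -/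
def Cond.cost : Cond R A → ℕ
  | .le x y => x.cost + y.cost + 1
  | .lt x y => x.cost + y.cost + 1
  | .eq x y => x.cost + y.cost + 1

variable [DecidableEq R] [DecidableEq A]

/-- Memory after the register `r` has received the value `z`. -/
def State.setReg (σ : State R A) (r : R) (z : ℤ) : State R A :=
  { σ with reg := Function.update σ.reg r z }

/-- Memory after the cell of the array `a` at the address `index` has received the value `z`. -/
def State.setCell (σ : State R A) (a : A) (index z : ℤ) : State R A :=
  { σ with arr := Function.update σ.arr a (Function.update (σ.arr a) index z) }

/-- `Exec s σ k σ'`: the program `s`, started with memory `σ`, halts after exactly `k` units of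
time with memory `σ'`. -/
inductive Exec : Stmt R A → State R A → ℕ → State R A → Prop where
  | skip (σ : State R A) : Exec .skip σ 1 σ
  | assign (σ : State R A) (r : R) (x : Expr R A) :
      Exec (.assign r x) σ (x.cost + 1) (σ.setReg r (x.eval σ))
  | store (σ : State R A) (a : A) (y x : Expr R A) :
      Exec (.store a y x) σ (y.cost + x.cost + 1) (σ.setCell a (y.eval σ) (x.eval σ))
  | seq {s s' : Stmt R A} {σ σ' σ'' : State R A} {k k' : ℕ} :
      Exec s σ k σ' → Exec s' σ' k' σ'' → Exec (.seq s s') σ (k + k') σ''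
  | branch_true {c : Cond R A} {s s' : Stmt R A} {σ σ' : State R A} {k : ℕ} :
      c.Holds σ → Exec s σ k σ' → Exec (.branch c s s') σ (c.cost + k) σ'
  | branch_false {c : Cond R A} {s s' : Stmt R A} {σ σ' : State R A} {k : ℕ} :
      ¬ c.Holds σ → Exec s' σ k σ' → Exec (.branch c s s') σ (c.cost + k) σ'
  | loop_true {c : Cond R A} {s : Stmt R A} {σ σ' σ'' : State R A} {k k' : ℕ} :
      c.Holds σ → Exec s σ k σ' → Exec (.loop c s) σ' k' σ'' →
      Exec (.loop c s) σ (c.cost + k + k') σ''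
  | loop_false {c : Cond R A} {s : Stmt R A} {σ : State R A} :
      ¬ c.Holds σ → Exec (.loop c s) σ c.cost σ

/-- Programs are deterministic: the running time and the final memory are determined by the
initial memory. -/
theorem Exec.deterministic {s : Stmt R A} {σ σ₁ σ₂ : State R A} {k₁ k₂ : ℕ}
    (h₁ : Exec s σ k₁ σ₁) (h₂ : Exec s σ k₂ σ₂) : k₁ = k₂ ∧ σ₁ = σ₂ := by
  induction h₁ generalizing k₂ σ₂ with
  | skip => cases h₂; exact ⟨rfl, rfl⟩
  | assign => cases h₂; exact ⟨rfl, rfl⟩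
  | store => cases h₂; exact ⟨rfl, rfl⟩
  | seq _ _ ih ih' =>
    cases h₂ with
    | seq g g' =>
      obtain ⟨rfl, rfl⟩ := ih g
      obtain ⟨rfl, rfl⟩ := ih' g'
      exact ⟨rfl, rfl⟩
  | branch_true h _ ih =>
    cases h₂ with
    | branch_true _ g => obtain ⟨rfl, rfl⟩ := ih g; exact ⟨rfl, rfl⟩
    | branch_false g _ => exact absurd h g
  | branch_false h _ ih =>
    cases h₂ with
    | branch_true g _ => exact absurd g h
    | branch_false _ g => obtain ⟨rfl, rfl⟩ := ih g; exact ⟨rfl, rfl⟩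
  | loop_true h _ _ ih ih' =>
    cases h₂ with
    | loop_true _ g g' =>
      obtain ⟨rfl, rfl⟩ := ih g
      obtain ⟨rfl, rfl⟩ := ih' g'
      exact ⟨rfl, rfl⟩
    | loop_false g => exact absurd h g
  | loop_false h =>
    cases h₂ with
    | loop_true g _ _ => exact absurd g h
    | loop_false _ => exact ⟨rfl, rfl⟩

end Semantics

/-! ### Abbreviations for writing programs -/

instance {R A : Type} : Add (Expr R A) := ⟨Expr.add⟩

instance {R A : Type} : Sub (Expr R A) := ⟨Expr.sub⟩

instance {R A : Type} (k : ℕ) : OfNat (Expr R A) k := ⟨Expr.const k⟩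

/-- Execute the statements of a list one after the other. -/
def block {R A : Type} : List (Stmt R A) → Stmt R A
  | [] => .skip
  | s :: l => .seq s (block l)

/-- `if c then s`. -/
def when {R A : Type} (c : Cond R A) (s : Stmt R A) : Stmt R A :=
  .branch c s .skip

/-- `for r = lo, lo + 1, …, hi do s`. -/
def forUp {R A : Type} (r : R) (lo hi : Expr R A) (s : Stmt R A) : Stmt R A :=
  block [.assign r lo, .loop (.le (.reg r) hi) (block [s, .assign r (.reg r + 1)])]

/-- `for r = hi, hi - 1, …, lo do s`. -/
def forDown {R A : Type} (r : R) (hi lo : Expr R A) (s : Stmt R A) : Stmt R A :=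
  block [.assign r hi, .loop (.le lo (.reg r)) (block [s, .assign r (.reg r - 1)])]

/-! ### The algorithms GPCA and ToFullMag as programs -/

/-- Registers. Input: the numbers `n` of jobs and `m` of tools and the capacity `C`.
Output: `value`, the number of switches. -/
inductive Reg where
  | n | m | C | value
  | pipesCount | lastFull | total
  | e | i | j | k | t | p | b
  deriving DecidableEq

/-- Arrays. Input: `len[i] = |T i|`, and `inp`, which lists `T 1, …, T n` one after the other.
Output: `mag`, in which the magazine state at job `i` starts at the address `base[i] = (i - 1) * C`
and has `card[i]` elements. -/
inductive Arr where
  | len | inp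
  | mag | base | card
  | lastSeen | used
  deriving DecidableEq

/-- The content of a register as an expression. -/
abbrev v (r : Reg) : Expr Reg Arr := .reg r

/-- `M_i := M_i ∪ {t}` for a tool `t` that is not in `M_i`, where `i` is the content of the
register `r`. -/
def append (r : Reg) : Stmt Reg Arr :=
  block [
    .store .mag (.cell .base (v r) + .cell .card (v r)) (v .t),
    .store .card (v r) (.cell .card (v r) + 1)]

/-- Greedy Pipe Construction Algorithm, in the implementation with `lastSeen` and `lastFull`,
followed by the computation of the number of switches. -/
def gpca : Stmt Reg Arr :=
  block [
    .assign .pipesCount 0,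
    .assign .lastFull 0,
    -- `lastSeen[t] := 1` for the tools of the first job, `-1` for all other tools
    forUp .t 1 (v .m) (.store .lastSeen (v .t) (.const (-1))),
    forUp .k 0 (.cell .len 1 - 1) (.store .lastSeen (.cell .inp (v .k)) 1),
    -- `M_i := T_i` for all `i`; `total` is the sum of all `|T_i|`
    .assign .total 0,
    .assign .p 0,
    .assign .b 0,
    forUp .i 1 (v .n) (block [
      .store .base (v .i) (v .b),
      .store .card (v .i) (.cell .len (v .i)),
      .assign .total (v .total + .cell .len (v .i)),
      forUp .k 0 (.cell .len (v .i) - 1) (block [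
        .store .mag (v .b + v .k) (.cell .inp (v .p)),
        .assign .p (v .p + 1)]),
      .assign .b (v .b + v .C)]),
    -- construct the pipes that end at `e`
    .assign .p (.cell .len 1),
    forUp .e 2 (v .n) (block [
      forUp .k 0 (.cell .len (v .e) - 1) (block [
        .assign .t (.cell .inp (v .p)),
        .assign .p (v .p + 1),
        when (.le (v .lastFull) (.cell .lastSeen (v .t))) (block [
          .assign .pipesCount (v .pipesCount + 1),
          forUp .i (.cell .lastSeen (v .t) + 1) (v .e - 1) (block [
            append .i,
            when (.eq (.cell .card (v .i)) (v .C)) (.assign .lastFull (v .i))])]),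
        .store .lastSeen (v .t) (v .e)]),
      when (.eq (.cell .card (v .e)) (v .C)) (.assign .lastFull (v .e))]),
    .assign .value (v .total - v .C - v .pipesCount)]

/-- Fill the empty slots of `M_j` with tools of `M_i`, as far as possible. -/
def fillFrom : Stmt Reg Arr :=
  block [
    forUp .k 0 (.cell .card (v .j) - 1)
      (.store .used (.cell .mag (.cell .base (v .j) + v .k)) 1),
    forUp .k 0 (.cell .card (v .i) - 1) (block [
      .assign .t (.cell .mag (.cell .base (v .i) + v .k)),
      when (.eq (.cell .used (v .t)) 0)
        (when (.lt (.cell .card (v .j)) (v .C)) (append .j))]),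
    forUp .k 0 (.cell .card (v .j) - 1)
      (.store .used (.cell .mag (.cell .base (v .j) + v .k)) 0)]

/-- ToFullMag: go through the pairs `(i, j) = (1, 2), …, (n - 1, n), (n, n - 1), …, (2, 1)`. -/
def toFullMag : Stmt Reg Arr :=
  block [
    forUp .t 1 (v .m) (.store .used (v .t) 0),
    forUp .j 2 (v .n) (block [.assign .i (v .j - 1), fillFrom]),
    forDown .j (v .n - 1) 1 (block [.assign .i (v .j + 1), fillFrom])]

/-! ### Input and output -/

/-- The `|S|` consecutive cells of an array that start at the address `start` contain the elements
of `S`, in some order. -/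
def Lists (a : ℤ → ℤ) (start : ℤ) (S : Finset ℕ) : Prop :=
  (Finset.range S.card).image (fun k : ℕ => a (start + (k : ℤ))) =
    S.image (fun t : ℕ => (t : ℤ))

/-- The memory contains the given input; nothing is assumed on the rest of the memory. -/
structure IsInput (n m C : ℕ) (T : ℕ → Finset ℕ) (σ : State Reg Arr) : Prop where
  reg_n : σ.reg .n = n
  reg_m : σ.reg .m = m
  reg_C : σ.reg .C = C
  len : ∀ i ∈ Finset.Icc 1 n, σ.arr .len i = (T i).card
  inp : ∀ i ∈ Finset.Icc 1 n,
    Lists (σ.arr .inp) (∑ j ∈ Finset.Ico 1 i, ((T j).card : ℤ)) (T i)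

/-- The memory contains the number `z` and the sequence `M 1, …, M n` of magazine states with `C`
slots as output. -/
structure IsOutput (n C : ℕ) (z : ℕ) (M : ℕ → Finset ℕ) (σ : State Reg Arr) : Prop where
  value : σ.reg .value = z
  mag : ∀ i ∈ Finset.Icc 1 n, Lists (σ.arr .mag) (((i : ℤ) - 1) * C) (M i)

end TLP

namespace TLP

/-! Call the stretch between two consecutive uses of a tool a gap, and say that a solution bridges
the gap if the tool stays in the magazine throughout. A use that does not end a bridged gap needs a
load of its own, in the first magazine or by a switch. Hence `C` plus the number of switches is at
least the sum of all `#(T i)` minus the number of bridged gaps (`sum_card_le`). The gaps bridged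
over job `i` occupy distinct slots not used by `T i` (`Feasible.coverage_le`), so the question
becomes how many intervals can be packed under capacities.

The greedy construction treats gaps by their right end and takes each one that still fits. For an
arbitrary solution, `GreedyInv.opt` keeps a set `S` of gaps still ahead that fit beside the pipes
built so far and, together with these, are at least as many as the gaps bridged by that solution.
Accepting a gap costs at most one member of `S` (`GreedyInv.accept`); rejecting one costs none
(`GreedyInv.reject`). At the end `S` is empty, so no solution bridges more gaps than there are
pipes. Conversely each pipe saves a load (`GreedyInv.card_add_switches_le`).

The greedy states may have empty slots. Filling from a neighbour does not increase `loads`. After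
the forward pass the last state is full, as otherwise it would contain all `m > C` tools; the
backward pass then carries fullness to all states. Now the first state has `C` tools and the two
bounds meet.

For the running time, pipe building is charged to the potential `∑ #(M i)`, which never exceeds `C *
n`; the remaining work is bounded through `n`, `m` and `∑ #(T i)`, all at most `C * n`. -/

open Finset

/-! ### Gaps between uses of a tool, and the lower bound on switches. -/

section Combinatorics

variable {n m C : ℕ} {T M M' : ℕ → Finset ℕ} {e f cnt t : ℕ} {D : Finset ℕ}

/-- The last job before job `e` that needs the tool `t`, or `0` if there is none. -/
def prev (T : ℕ → Finset ℕ) (t : ℕ) : ℕ → ℕ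
  | 0 => 0
  | e + 1 => if t ∈ T e then e else prev T t e

theorem prev_succ_of_mem (h : t ∈ T e) : prev T t (e + 1) = e := by simp [prev, h]

theorem prev_succ_of_notMem (h : t ∉ T e) : prev T t (e + 1) = prev T t e := by simp [prev, h]

theorem prev_lt (he : 0 < e) : prev T t e < e := by
  induction e with
  | zero => omega
  | succ e ih =>
    by_cases h : t ∈ T e
    · simp [prev, h]
    · rw [prev_succ_of_notMem h]
      rcases Nat.eq_zero_or_pos e with rfl | h'
      · simp [prev]
      · have := ih h'; omega

theorem mem_prev (h : prev T t e ≠ 0) : t ∈ T (prev T t e) := by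
  induction e with
  | zero => simp [prev] at h
  | succ e ih =>
    by_cases h' : t ∈ T e
    · rwa [prev_succ_of_mem h']
    · rw [prev_succ_of_notMem h'] at h ⊢
      exact ih h

theorem le_prev {i : ℕ} (h : t ∈ T i) (hi : i < e) : i ≤ prev T t e := by
  induction e with
  | zero => omega
  | succ e ih =>
    by_cases h' : t ∈ T e
    · rw [prev_succ_of_mem h']; omega
    · rw [prev_succ_of_notMem h']
      refine ih (lt_of_le_of_ne (by omega) ?_)
      rintro rfl
      exact h' h

/-- A pair `⟨e, t⟩` stands for the gap between job `e` and the last job before `e` that needs `t`.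
`coverage T S i` is the number of gaps in `S` that contain job `i`. -/
def coverage (T : ℕ → Finset ℕ) (S : Finset ((_ : ℕ) × ℕ)) (i : ℕ) : ℕ :=
  #{x ∈ S | prev T x.2 x.1 < i ∧ i < x.1}

/-- The tools of job `e` that stay in the magazine since the last job that needed them. -/
def keptAt (T M : ℕ → Finset ℕ) (e : ℕ) : Finset ℕ :=
  {t ∈ T e | prev T t e ≠ 0 ∧ ∀ i ∈ Ioo (prev T t e) e, t ∈ M i}

/-- The tool `t` has been used since it was inserted into the magazine of job `e`. -/
def UsedSince (T M : ℕ → Finset ℕ) (e t : ℕ) : Prop :=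
  prev T t (e + 1) ≠ 0 ∧ ∀ i ∈ Ioc (prev T t (e + 1)) e, t ∈ M i

open Classical in
/-- The tools in the magazine at job `e` that have not been used since they were inserted. -/
noncomputable def unused (T M : ℕ → Finset ℕ) (e : ℕ) : Finset ℕ :=
  {t ∈ M e | ¬ UsedSince T M e t}

theorem mem_unused : t ∈ unused T M e ↔
    t ∈ M e ∧ ¬ (prev T t (e + 1) ≠ 0 ∧ ∀ i ∈ Ioc (prev T t (e + 1)) e, t ∈ M i) := by
  classical
  rw [unused, mem_filter, UsedSince]

theorem unused_subset : unused T M e ⊆ M e := fun _ ht => (mem_unused.1 ht).1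

/-- A tool that is unused at `e + 1`, or needed there without having been kept, was already unused
at `e` or has just been inserted. The two kinds are disjoint, because a tool needed at `e + 1`
counts as used. So one insertion never pays for two uses. -/
theorem card_unused_add_card_le (hT : T (e + 1) ⊆ M (e + 1)) :
    #(unused T M (e + 1)) + #(T (e + 1)) ≤
      #(unused T M e) + #(M (e + 1) \ M e) + #(keptAt T M (e + 1)) := by
  have h₁ : #(T (e + 1)) = #(T (e + 1) \ keptAt T M (e + 1)) + #(keptAt T M (e + 1)) :=
    (card_sdiff_add_card_eq_card (filter_subset _ _)).symm
  have hd : Disjoint (unused T M (e + 1)) (T (e + 1) \ keptAt T M (e + 1)) := by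
    rw [disjoint_left]
    intro t ht ht'
    simp only [mem_unused, mem_sdiff] at ht ht'
    refine ht.2 ?_
    rw [prev_succ_of_mem ht'.1]
    simp
  have hs : unused T M (e + 1) ∪ (T (e + 1) \ keptAt T M (e + 1)) ⊆
      unused T M e ∪ (M (e + 1) \ M e) := by
    intro t ht
    by_cases hMe : t ∈ M e
    swap
    · simp only [mem_union, mem_sdiff, mem_unused] at ht ⊢
      exact Or.inr ⟨ht.elim (fun h => h.1) (fun h => hT h.1), hMe⟩
    refine mem_union_left _ (mem_unused.2 ⟨hMe, fun ⟨h0, hl⟩ => ?_⟩)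
    by_cases htT : t ∈ T (e + 1)
    · have hk : t ∈ keptAt T M (e + 1) := by
        refine mem_filter.2 ⟨htT, h0, fun i hi => hl i ?_⟩
        simp only [mem_Ioo, mem_Ioc] at hi ⊢
        omega
      rw [mem_union, mem_sdiff] at ht
      rcases ht with ht | ht
      · refine (mem_unused.1 ht).2 ?_
        rw [prev_succ_of_mem htT]
        simp
      · exact ht.2 hk
    · rw [mem_union, mem_sdiff] at ht
      rcases ht with ht | ht
      · simp only [mem_unused] at ht
        refine ht.2 ⟨by rwa [prev_succ_of_notMem htT], fun i hi => ?_⟩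
        rw [prev_succ_of_notMem htT, mem_Ioc] at hi
        rcases Nat.lt_or_ge e i with h | h
        · obtain rfl : i = e + 1 := by omega
          exact ht.1
        · exact hl i (mem_Ioc.2 ⟨hi.1, h⟩)
      · exact htT ht.1
  have h₂ := card_le_card hs
  rw [card_union_of_disjoint hd] at h₂
  have h₃ := card_union_le (unused T M e) (M (e + 1) \ M e)
  omega

theorem switches_succ (he : 1 ≤ e) :
    switches (e + 1) M = switches e M + #(M (e + 1) \ M e) := by
  simp [switches, sum_Ico_succ_top he]

/-- Every use of a tool is paid for by a kept tool, an insertion, or the initial magazine. -/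
theorem sum_card_le (h : ∀ i ∈ Icc 1 n, T i ⊆ M i) (he : 1 ≤ e) (hn : e ≤ n) :
    ∑ i ∈ Icc 1 e, #(T i) + #(unused T M e) ≤
      #(M 1) + switches e M + ∑ i ∈ Icc 1 e, #(keptAt T M i) := by
  induction e, he using Nat.le_induction with
  | base =>
    have hd : Disjoint (T 1) (unused T M 1) := by
      rw [disjoint_left]
      intro t ht ht'
      simp only [mem_unused] at ht'
      refine ht'.2 ?_
      rw [prev_succ_of_mem ht]
      simp
    have := card_le_card (union_subset (h 1 (by simp; omega)) (unused_subset (T := T) (e := 1)))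
    rw [card_union_of_disjoint hd] at this
    simp
    omega
  | succ e he ih =>
    have := ih (by omega)
    have h₂ := card_unused_add_card_le (h (e + 1) (by simp; omega))
    rw [sum_Icc_succ_top (by omega), sum_Icc_succ_top (by omega), switches_succ he]
    omega

/-! ### Optimality of the greedy pipe construction. -/

/-- The invariant of the greedy pipe construction, when the pipes that end before `e`, and those
that end at `e` with a tool of `D`, have been considered. -/
structure GreedyInv (n m C : ℕ) (T : ℕ → Finset ℕ) (e : ℕ) (D : Finset ℕ) (M : ℕ → Finset ℕ)
    (f cnt : ℕ) : Prop where
  two_le : 2 ≤ e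
  le_succ : e ≤ n + 1
  subset_done : D ⊆ T e
  subset : ∀ i ∈ Icc 1 n, T i ⊆ M i
  subset_tools : ∀ i ∈ Icc 1 n, M i ⊆ Icc 1 m
  card_le : ∀ i ∈ Icc 1 n, #(M i) ≤ C
  eq_of_le : ∀ i, e ≤ i → M i = T i
  fresh : ∀ t i, t ∉ D → prev T t e < i → i < e → t ∉ M i
  full_lt : f < e
  full : f ≠ 0 → #(M f) = C
  -- Job 1 is exempt: it may be full while `f = 0`, but it never lies strictly inside a gap.
  not_full : ∀ i, 2 ≤ i → f < i → i < e → #(M i) < C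
  -- The term `#(D \ M (e - 1))` counts the treated tools of job `e` that must be inserted there.
  count : #(M 1) + switches (e - 1) M + cnt + #(D \ M (e - 1)) ≤ ∑ i ∈ Ico 1 e, #(T i) + #D
  opt : ∀ M', Feasible n m C T M' → ∃ S : Finset ((_ : ℕ) × ℕ),
    (∀ x ∈ S, x.2 ∈ T x.1 ∧ prev T x.2 x.1 ≠ 0 ∧ e ≤ x.1 ∧ x.1 ≤ n ∧ (x.1 = e → x.2 ∉ D)) ∧
    (∀ i ∈ Icc 1 n, coverage T S i + #(M i) ≤ C) ∧
    ∑ i ∈ Icc 1 n, #(keptAt T M' i) ≤ cnt + #S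

/-- The gaps that are bridged by a feasible solution fit into the free slots. -/
theorem Feasible.coverage_le (h : Feasible n m C T M) {i : ℕ} (hi : i ∈ Icc 1 n) :
    coverage T ((Icc 1 n).sigma (keptAt T M)) i + #(T i) ≤ C := by
  obtain ⟨hT, -, hC⟩ := h i hi
  -- Gaps of the same tool are disjoint, so the gaps over `i` have distinct tools, none of them
  -- needed at `i`.
  have : coverage T ((Icc 1 n).sigma (keptAt T M)) i ≤ #(M i \ T i) := by
    refine card_le_card_of_injOn (fun x => x.2) ?_ ?_
    · rintro ⟨e, t⟩ hx
      simp only [coe_filter, Set.mem_ofPred_eq, mem_sigma, keptAt, mem_filter, mem_Ioo, coe_sdiff,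
        Set.mem_sdiff, mem_coe] at hx ⊢
      refine ⟨hx.1.2.2.2 i hx.2, fun hti => ?_⟩
      have := le_prev hti hx.2.2
      omega
    · rintro ⟨e, t⟩ hx ⟨e', t'⟩ hx' (rfl : t = t')
      simp only [coe_filter, Set.mem_ofPred_eq, mem_sigma, keptAt, mem_filter] at hx hx'
      rcases lt_trichotomy e e' with hlt | rfl | hlt
      · have := le_prev hx.1.2.1 hlt
        omega
      · rfl
      · have := le_prev hx'.1.2.1 hlt
        omega
  rw [card_sdiff_of_subset hT] at this
  have := card_le_card hT
  omega

theorem GreedyInv.init (h : IsInstance n m C T) (hn : 1 ≤ n) : GreedyInv n m C T 2 ∅ T 0 0 where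
  two_le := le_rfl
  le_succ := by omega
  subset_done := by simp
  subset _ _ := Subset.rfl
  subset_tools i hi := h.union_eq ▸ subset_biUnion_of_mem T hi
  card_le := h.card_le
  eq_of_le _ _ := rfl
  fresh t i _ hi hi' ht := by
    have := le_prev ht hi'
    omega
  full_lt := by omega
  full := by simp
  not_full := by omega
  count := by simp [switches]
  opt M' hM' := by
    refine ⟨(Icc 1 n).sigma (keptAt T M'), ?_, fun i hi => hM'.coverage_le hi, by simp⟩
    rintro ⟨e, t⟩ hx
    simp only [mem_sigma, keptAt, mem_filter, mem_Icc] at hx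
    refine ⟨hx.2.1, hx.2.2.1, ?_, hx.1.2, by simp⟩
    -- A gap starts at job 1 or later, so it ends at job 2 or later.
    by_contra hlt
    have := prev_lt (T := T) (t := t) (e := e) (by omega)
    have := hx.2.2.1
    simp only at *
    omega

/-- Either there is no gap, or the full job `f` lies strictly inside it. In both cases it is not in
`S`, which can stay as it is. -/
theorem GreedyInv.reject (h : GreedyInv n m C T e D M f cnt) (hn : e ≤ n) (ht : t ∈ T e)
    (hD : t ∉ D) (hp : prev T t e = 0 ∨ prev T t e < f) :
    GreedyInv n m C T e (insert t D) M f cnt where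
  two_le := h.two_le
  le_succ := h.le_succ
  subset_done := insert_subset ht h.subset_done
  subset := h.subset
  subset_tools := h.subset_tools
  card_le := h.card_le
  eq_of_le := h.eq_of_le
  fresh u i hu := h.fresh u i (fun hu' => hu (mem_insert_of_mem hu'))
  full_lt := h.full_lt
  full := h.full
  not_full := h.not_full
  count := by
    have h₁ := h.count
    have h₂ : #(insert t D \ M (e - 1)) ≤ #(D \ M (e - 1)) + 1 :=
      by
      refine (card_le_card (t := insert t (D \ M (e - 1))) ?_).trans (card_insert_le _ _)
      intro u
      simp only [mem_sdiff, mem_insert]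
      tauto
    rw [card_insert_of_notMem hD]
    omega
  opt M' hM' := by
    obtain ⟨S, hS, hc, hk⟩ := h.opt M' hM'
    refine ⟨S, fun x hx => ?_, hc, hk⟩
    obtain ⟨h₀, h₁, h₂, h₃, h₄⟩ := hS x hx
    refine ⟨h₀, h₁, h₂, h₃, fun hxe hxD => ?_⟩
    rcases mem_insert.1 hxD with hxt | hxD
    · obtain ⟨e', t'⟩ := x
      simp only at hxt hxe
      subst hxt hxe
      rcases hp with hp | hp
      · exact h₁ hp
      · have hf := h.full_lt
        have hpos : 0 < coverage T S f := card_pos.2 ⟨_, mem_filter.2 ⟨hx, hp, hf⟩⟩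
        have := hc f (mem_Icc.2 (by omega))
        have := h.full (by omega)
        omega
    · exact h₄ hxe hxD

/-- The magazine states after the tool `t` has been added strictly between `s` and `e`. -/
def pipe (M : ℕ → Finset ℕ) (t s e : ℕ) : ℕ → Finset ℕ :=
  fun i => if s < i ∧ i < e then insert t (M i) else M i

theorem card_sdiff_insert_le_card_sdiff {A B : Finset ℕ} {t : ℕ} : #(A \ insert t B) ≤ #(A \ B) :=
  card_le_card (sdiff_subset_sdiff Subset.rfl (subset_insert _ _))

/-- The tool is already present at `s`, so the pipe begins without an insertion, and its removal
after job `e - 1` is free. -/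
theorem switches_pipe_le {s e k : ℕ} (hs : t ∈ M s) (hk : k < e) :
    switches k (pipe M t s e) ≤ switches k M := by
  refine sum_le_sum fun i hi => ?_
  have hi := mem_Ico.1 hi
  by_cases h₁ : s < i
  · rw [pipe, pipe, if_pos (by omega), if_pos (by omega)]
    rw [insert_sdiff_of_mem _ (mem_insert_self _ _)]
    exact card_sdiff_insert_le_card_sdiff
  · rw [pipe, pipe, if_neg (c := s < i ∧ i < e) (by omega)]
    split_ifs with h₂
    · obtain rfl : i = s := by omega
      rw [insert_sdiff_of_mem _ hs]
    · exact le_rfl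

theorem coverage_erase_le {S : Finset ((_ : ℕ) × ℕ)} {x : (_ : ℕ) × ℕ} (i : ℕ) :
    coverage T (S.erase x) i ≤ coverage T S i :=
  card_le_card (filter_subset_filter _ (erase_subset _ _))

theorem coverage_erase_lt {S : Finset ((_ : ℕ) × ℕ)} {x : (_ : ℕ) × ℕ} {i : ℕ} (hx : x ∈ S)
    (hi : prev T x.2 x.1 < i ∧ i < x.1) : coverage T (S.erase x) i < coverage T S i := by
  refine card_lt_card ⟨filter_subset_filter _ (erase_subset _ _), fun h => ?_⟩
  have := h (mem_filter.2 ⟨hx, hi⟩)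
  simp at this

/-- The exchange step. If the accepted gap is in `S`, it moves from `S` to the pipes. Otherwise let
`p` be the first job inside it at which `S` and the pipes leave no room. Some gap of `S` passes over
`p`; it ends no earlier than `e`, so dropping it makes room at every job from `p` to `e - 1`. If no
such `p` exists, nothing is dropped. The new value `f'` is supplied by the program. -/
theorem GreedyInv.accept (h : GreedyInv n m C T e D M f cnt) (hn : e ≤ n) (ht : t ∈ T e)
    (hD : t ∉ D) (hp : prev T t e ≠ 0) (hf : f ≤ prev T t e) {f' : ℕ} (hf' : f' < e)
    (hfull : f' ≠ 0 → #(pipe M t (prev T t e) e f') = C)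
    (hnot : ∀ i, 2 ≤ i → f' < i → i < e → #(pipe M t (prev T t e) e i) < C) :
    GreedyInv n m C T e (insert t D) (pipe M t (prev T t e) e) f' (cnt + 1) := by
  have he := h.two_le
  have hlt : prev T t e < e := prev_lt (by omega)
  have hpM : t ∈ M (prev T t e) := h.subset _ (mem_Icc.2 (by omega)) (mem_prev hp)
  have hte : t ∈ Icc 1 m := h.subset_tools e (mem_Icc.2 (by omega)) (h.subset _ (mem_Icc.2 (by omega)) ht)
  have hsub : ∀ i, M i ⊆ pipe M t (prev T t e) e i := by
    intro i
    rw [pipe]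
    split_ifs
    · exact subset_insert _ _
    · exact Subset.rfl
  have hcard : ∀ i, prev T t e < i → i < e → #(pipe M t (prev T t e) e i) = #(M i) + 1 := by
    intro i h₁ h₂
    rw [pipe, if_pos ⟨h₁, h₂⟩, card_insert_of_notMem (h.fresh t i hD h₁ h₂)]
  have hcard' : ∀ i, ¬ (prev T t e < i ∧ i < e) → pipe M t (prev T t e) e i = M i :=
    fun i hi => if_neg hi
  refine ⟨he, h.le_succ, insert_subset ht h.subset_done, fun i hi => (h.subset i hi).trans (hsub i),
    fun i hi => ?_, fun i hi => ?_, fun i hi => ?_, fun u i hu h₁ h₂ => ?_, hf', hfull, hnot, ?_, ?_⟩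
  · rw [pipe]
    split_ifs
    · exact insert_subset hte (h.subset_tools i hi)
    · exact h.subset_tools i hi
  · by_cases hc : prev T t e < i ∧ i < e
    · rw [hcard i hc.1 hc.2]
      exact h.not_full i (by omega) (by omega) hc.2
    · rw [hcard' i hc]
      exact h.card_le i hi
  · rw [hcard' i (by omega), h.eq_of_le i hi]
  · have hu' : u ≠ t ∧ u ∉ D := by simpa using hu
    rw [pipe]
    split_ifs
    · rw [mem_insert, not_or]
      exact ⟨hu'.1, h.fresh u i hu'.2 h₁ h₂⟩
    · exact h.fresh u i hu'.2 h₁ h₂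
  -- The tool `t` is now present at `e - 1`: `cnt` and `#D` grow by one, and the other terms do not
  -- grow.
  · have h₁ := h.count
    have h₂ : switches (e - 1) (pipe M t (prev T t e) e) ≤ switches (e - 1) M :=
      switches_pipe_le hpM (by omega)
    have h₃ : t ∈ pipe M t (prev T t e) e (e - 1) := by
      rw [pipe]
      split_ifs with hc
      · exact mem_insert_self _ _
      · obtain hc : e - 1 = prev T t e := by omega
        rwa [hc]
    have h₄ : #(D \ pipe M t (prev T t e) e (e - 1)) ≤ #(D \ M (e - 1)) :=
      card_le_card (sdiff_subset_sdiff Subset.rfl (hsub _))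
    rw [hcard' 1 (by omega), insert_sdiff_of_mem _ h₃, card_insert_of_notMem hD]
    omega
  · intro M' hM'
    obtain ⟨S, hS, hc, hk⟩ := h.opt M' hM'
    have aux : ∀ x ∈ S, (x ≠ ⟨e, t⟩) → (x.1 = e → x.2 ∉ insert t D) := by
      intro x hx hxne hxe hxD
      rcases mem_insert.1 hxD with hxt | hxD
      · exact hxne (Sigma.ext hxe (heq_of_eq hxt))
      · exact (hS x hx).2.2.2.2 hxe hxD
    by_cases hmem : (⟨e, t⟩ : (_ : ℕ) × ℕ) ∈ S
    · refine ⟨S.erase ⟨e, t⟩, fun x hx => ?_, fun i hi => ?_, ?_⟩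
      · have hx' := mem_of_mem_erase hx
        obtain ⟨h₀, h₁, h₂, h₃, -⟩ := hS x hx'
        exact ⟨h₀, h₁, h₂, h₃, aux x hx' (ne_of_mem_erase hx)⟩
      · have := hc i hi
        by_cases hi' : prev T t e < i ∧ i < e
        · rw [hcard i hi'.1 hi'.2]
          have := coverage_erase_lt (T := T) hmem hi'
          omega
        · rw [hcard' i hi']
          have := coverage_erase_le (T := T) (S := S) (x := ⟨e, t⟩) i
          omega
      · have := card_erase_add_one hmem
        omega
    have aux' : ∀ x ∈ S, (x.1 = e → x.2 ∉ insert t D) :=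
      fun x hx => aux x hx fun hxe => hmem (hxe ▸ hx)
    by_cases htight : ∃ p, prev T t e < p ∧ p < e ∧ C ≤ coverage T S p + #(M p)
    swap
    · push Not at htight
      refine ⟨S, fun x hx => ?_, fun i hi => ?_, by omega⟩
      · obtain ⟨h₀, h₁, h₂, h₃, -⟩ := hS x hx
        exact ⟨h₀, h₁, h₂, h₃, aux' x hx⟩
      · by_cases hi' : prev T t e < i ∧ i < e
        · rw [hcard i hi'.1 hi'.2]
          have := htight i hi'.1 hi'.2
          omega
        · rw [hcard' i hi']
          exact hc i hi
    · classical
      obtain ⟨hp₁, hp₂, hp₃⟩ := Nat.find_spec htight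
      have hmin : ∀ i, i < Nat.find htight → _ := fun i hi => Nat.find_min htight hi
      generalize Nat.find htight = p at hp₁ hp₂ hp₃ hmin
      -- The pipes alone do not fill `p`, so a gap of `S` must pass over it.
      have hpn := h.not_full p (by omega) (by omega) hp₂
      have hpos : 0 < coverage T S p := by omega
      obtain ⟨x, hx⟩ := card_pos.1 hpos
      obtain ⟨hxS, hxp, hpx⟩ := mem_filter.1 hx
      refine ⟨S.erase x, fun y hy => ?_, fun i hi => ?_, ?_⟩
      · have hy' := mem_of_mem_erase hy
        obtain ⟨h₀, h₁, h₂, h₃, -⟩ := hS y hy'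
        exact ⟨h₀, h₁, h₂, h₃, aux' y hy'⟩
      · have := hc i hi
        have hle := coverage_erase_le (T := T) (S := S) (x := x) i
        by_cases hi' : prev T t e < i ∧ i < e
        · rw [hcard i hi'.1 hi'.2]
          rcases Nat.lt_or_ge i p with hip | hip
          · have := hmin i hip
            push Not at this
            have := this hi'.1 hi'.2
            omega
          · have := coverage_erase_lt (T := T) hxS (i := i)
              ⟨by omega, by have := (hS x hxS).2.2.1; omega⟩
            omega
        · rw [hcard' i hi']
          omega
      · have := card_erase_add_one hxS
        omega

/-- Since `M e` is still `T e`, the term `#(D \ M (e - 1))` with `D = T e` becomes the number of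
switches at job `e`. -/
theorem GreedyInv.finish (h : GreedyInv n m C T e (T e) M f cnt) (hn : e ≤ n) :
    GreedyInv n m C T (e + 1) ∅ M (if #(M e) = C then e else f) cnt := by
  have he := h.two_le
  have hMe := h.eq_of_le e le_rfl
  have hf := h.full_lt
  refine ⟨by omega, by omega, by simp, h.subset, h.subset_tools, h.card_le,
    fun i hi => h.eq_of_le i (by omega), fun t i _ h₁ h₂ => ?_, ?_, ?_, fun i h₁ h₂ h₃ => ?_, ?_, ?_⟩
  · by_cases hte : t ∈ T e
    · rw [prev_succ_of_mem hte] at h₁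
      omega
    · rw [prev_succ_of_notMem hte] at h₁
      rcases Nat.lt_or_ge i e with hi | hi
      · exact h.fresh t i hte h₁ hi
      · obtain rfl : i = e := by omega
        rwa [hMe]
  · split_ifs <;> omega
  · split_ifs with hc
    · exact fun _ => hc
    · exact h.full
  · split_ifs at h₂ with hc
    · omega
    · rcases Nat.lt_or_ge i e with hi | hi
      · exact h.not_full i h₁ h₂ hi
      · obtain rfl : i = e := by omega
        exact lt_of_le_of_ne (h.card_le i (mem_Icc.2 (by omega))) hc
  · have h₁ := h.count
    obtain ⟨e, rfl⟩ : ∃ k, e = k + 1 := ⟨e - 1, by omega⟩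
    simp only [Nat.add_sub_cancel] at h₁ ⊢
    rw [switches_succ (by omega), hMe, sum_Ico_succ_top (by omega)]
    simp
    omega
  · intro M' hM'
    obtain ⟨S, hS, hc, hk⟩ := h.opt M' hM'
    refine ⟨S, fun x hx => ?_, hc, hk⟩
    obtain ⟨h₀, h₁, h₂, h₃, h₄⟩ := hS x hx
    refine ⟨h₀, h₁, ?_, h₃, by simp⟩
    by_contra hlt
    obtain hxe : x.1 = e := by omega
    exact h₄ hxe (hxe ▸ h₀)

/-- The greedy pipe construction bounds the number of switches of every solution from below. -/
theorem GreedyInv.sum_card_le (h : GreedyInv n m C T (n + 1) ∅ M f cnt)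
    (hM' : Feasible n m C T M') : ∑ i ∈ Icc 1 n, #(T i) ≤ C + switches n M' + cnt := by
  have hn := h.two_le
  obtain ⟨S, hS, -, hk⟩ := h.opt M' hM'
  have hS0 : S = ∅ := eq_empty_of_forall_notMem fun x hx => by have := hS x hx; omega
  have := TLP.sum_card_le (fun i hi => (hM' i hi).1) (show 1 ≤ n by omega) le_rfl
  rw [(hM' 1 (by simp; omega)).2.2] at this
  simp [hS0] at hk
  omega

theorem GreedyInv.card_add_switches_le (h : GreedyInv n m C T (n + 1) ∅ M f cnt) :
    #(M 1) + switches n M + cnt ≤ ∑ i ∈ Icc 1 n, #(T i) := by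
  have := h.count
  simpa [← Ico_add_one_right_eq_Icc] using this

/-! ### Filling the magazine -/

theorem card_sdiff_eq_of_subset_union {A B S : Finset ℕ} (hBA : B ⊆ A) (hAB : A ⊆ B ∪ S) :
    #(A \ S) = #(B \ S) := by
  congr 1
  ext x
  have := @hBA x
  have := @hAB x
  simp only [mem_sdiff, mem_union] at *
  tauto

/-- Adding tools of the preceding magazine state does not increase the number of switches. -/
theorem switches_update_le_of_pred {A : Finset ℕ} {j : ℕ} (hj : 2 ≤ j)
    (h₁ : M j ⊆ A) (h₂ : A ⊆ M j ∪ M (j - 1)) :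
    switches n (Function.update M j A) ≤ switches n M := by
  refine sum_le_sum fun i hi => ?_
  rcases eq_or_ne i j with rfl | hij
  · rw [Function.update_self, Function.update_of_ne (by omega)]
    exact card_le_card (sdiff_subset_sdiff Subset.rfl h₁)
  · rw [Function.update_of_ne hij]
    rcases eq_or_ne (i + 1) j with rfl | hij'
    · rw [Function.update_self]
      exact (card_sdiff_eq_of_subset_union h₁ h₂).le
    · rw [Function.update_of_ne hij']

/-- The size of the first magazine state plus the number of switches. -/
def loads (n : ℕ) (M : ℕ → Finset ℕ) : ℕ := #(M 1) + switches n M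

theorem loads_update_le_of_pred {A : Finset ℕ} {j : ℕ} (hj : 2 ≤ j)
    (h₁ : M j ⊆ A) (h₂ : A ⊆ M j ∪ M (j - 1)) :
    loads n (Function.update M j A) ≤ loads n M := by
  have := switches_update_le_of_pred (n := n) hj h₁ h₂
  rw [loads, loads, Function.update_of_ne (by omega)]
  omega

theorem loads_succ (he : 1 ≤ e) : loads (e + 1) M = loads e M + #(M (e + 1) \ M e) := by
  rw [loads, loads, switches_succ he, Nat.add_assoc]

theorem loads_congr (he : 1 ≤ e) (h : ∀ i ∈ Icc 1 e, M i = M' i) : loads e M = loads e M' := by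
  rw [loads, loads, h 1 (by simp; omega), switches, switches]
  congr 1
  refine sum_congr rfl fun i hi => ?_
  have := mem_Ico.1 hi
  rw [h i (by simp; omega), h (i + 1) (by simp; omega)]

/-- Each added tool costs at most one load at `j`. The transition to `j + 1`, where this load is
saved again, is not yet counted. -/
theorem loads_update_self_le {A : Finset ℕ} {j : ℕ} (hj : 1 ≤ j) (h₁ : M j ⊆ A) :
    loads j (Function.update M j A) ≤ loads j M + #(A \ M j) := by
  rcases Nat.lt_or_ge 1 j with hj' | hj'
  · obtain ⟨j, rfl⟩ : ∃ k, j = k + 1 := ⟨j - 1, by omega⟩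
    rw [loads_succ (by omega), loads_succ (by omega), Function.update_self,
      Function.update_of_ne (by omega), loads_congr (M' := M) (by omega)]
    · have : A \ M j ⊆ (M (j + 1) \ M j) ∪ (A \ M (j + 1)) := by
        intro x
        simp only [mem_sdiff, mem_union]
        tauto
      have := (card_le_card this).trans (card_union_le _ _)
      omega
    · intro i hi
      rw [Function.update_of_ne]
      have := mem_Icc.1 hi
      omega
  · obtain rfl : j = 1 := by omega
    simp only [loads, Function.update_self, switches, Ico_self, sum_empty]
    rw [card_sdiff_of_subset h₁]
    omega

/-- Adding tools of the following magazine state does not increase the number of loads. -/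
theorem loads_update_le_of_succ {A : Finset ℕ} {j : ℕ} (hj : 1 ≤ j) (hjn : j < n)
    (h₁ : M j ⊆ A) (h₂ : A ⊆ M j ∪ M (j + 1)) :
    loads n (Function.update M j A) ≤ loads n M := by
  induction n, hjn using Nat.le_induction with
  | base =>
    rw [loads_succ hj, loads_succ hj, Function.update_self, Function.update_of_ne (by omega)]
    have h := loads_update_self_le hj h₁
    -- The added tools were loaded at `j + 1` before, so their loads only move from `j + 1` to `j`.
    have hd : Disjoint (A \ M j) (M (j + 1) \ A) := by
      rw [disjoint_left]
      intro x
      simp only [mem_sdiff]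
      tauto
    have hs : (A \ M j) ∪ (M (j + 1) \ A) ⊆ M (j + 1) \ M j := by
      intro x
      have := @h₁ x
      have := @h₂ x
      simp only [mem_sdiff, mem_union] at *
      tauto
    have := card_le_card hs
    rw [card_union_of_disjoint hd] at this
    omega
  | succ k hk ih =>
    rw [loads_succ (by omega), loads_succ (by omega), Function.update_of_ne (by omega),
      Function.update_of_ne (by omega)]
    omega

/-- If every magazine state that is not full contains the preceding one, the last one is full. -/
theorem card_last_of_forall (h : IsInstance n m C T) (hn : 1 ≤ n)
    (hT : ∀ i ∈ Icc 1 n, T i ⊆ M i) (hC : ∀ i ∈ Icc 1 n, #(M i) ≤ C)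
    (hM : ∀ i ∈ Ico 1 n, #(M (i + 1)) = C ∨ M i ⊆ M (i + 1)) : #(M n) = C := by
  -- Fullness is inherited along inclusions, since no state exceeds `C`.
  have key : ∀ k, 1 ≤ k → k ≤ n → #(M k) = C ∨ ∀ i ∈ Icc 1 k, M i ⊆ M k := by
    intro k hk
    induction k, hk using Nat.le_induction with
    | base =>
      intro _
      refine Or.inr fun i hi => ?_
      obtain rfl : i = 1 := by simp at hi; omega
      exact Subset.rfl
    | succ k hk ih =>
      intro hkn
      rcases hM k (by simp; omega) with h' | h'
      · exact Or.inl h'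
      · rcases ih (by omega) with h'' | h''
        · have := hC (k + 1) (by simp; omega)
          have := card_le_card h'
          omega
        · refine Or.inr fun i hi => ?_
          rcases eq_or_ne i (k + 1) with rfl | hik
          · exact Subset.rfl
          · exact (h'' i (by simp at hi ⊢; omega)).trans h'
  rcases key n hn le_rfl with h' | h'
  · exact h'
  · have hs : Icc 1 m ⊆ M n := by
      rw [← h.union_eq]
      exact biUnion_subset.2 fun i hi => (hT i hi).trans (h' i hi)
    have := card_le_card hs
    have := hC n (by simp; omega)
    have := h.lt
    simp at *
    omega

/-! ### Size bounds for instances, used in the time estimates. -/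

theorem IsInstance.one_le_C (h : IsInstance n m C T) : 1 ≤ C := by
  by_contra hC
  have hm := h.lt
  have : m ∈ (Icc 1 n).biUnion T := by rw [h.union_eq]; simp; omega
  obtain ⟨i, hi, hmi⟩ := mem_biUnion.1 this
  have := h.card_le i hi
  have := card_pos.2 ⟨m, hmi⟩
  omega

theorem IsInstance.one_le_n (h : IsInstance n m C T) : 1 ≤ n := by
  by_contra hn
  have hm := h.lt
  have : m ∈ (Icc 1 n).biUnion T := by rw [h.union_eq]; simp; omega
  obtain rfl : n = 0 := by omega
  simp at this

theorem IsInstance.sum_card_le (h : IsInstance n m C T) : ∑ i ∈ Icc 1 n, #(T i) ≤ C * n := by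
  have := sum_le_card_nsmul _ _ _ h.card_le
  simpa [Nat.mul_comm] using this

theorem IsInstance.le_sum_card (h : IsInstance n m C T) : m ≤ ∑ i ∈ Icc 1 n, #(T i) := by
  have := card_biUnion_le (s := Icc 1 n) (t := T)
  rw [h.union_eq] at this
  simpa using this

end Combinatorics

/-! ### Reasoning about programs -/

section Expressions

variable {R A : Type} {σ : State R A}

@[simp] theorem Expr.eval_const (z : ℤ) : (Expr.const z : Expr R A).eval σ = z := rfl
@[simp] theorem Expr.eval_reg (r : R) : (Expr.reg r : Expr R A).eval σ = σ.reg r := rfl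
@[simp] theorem Expr.eval_cell (a : A) (x : Expr R A) :
    (Expr.cell a x).eval σ = σ.arr a (x.eval σ) := rfl
@[simp] theorem Expr.eval_add (x y : Expr R A) : (x + y).eval σ = x.eval σ + y.eval σ := rfl
@[simp] theorem Expr.eval_sub (x y : Expr R A) : (x - y).eval σ = x.eval σ - y.eval σ := rfl
@[simp] theorem Expr.eval_zero : (0 : Expr R A).eval σ = 0 := rfl
@[simp] theorem Expr.eval_one : (1 : Expr R A).eval σ = 1 := rfl
@[simp] theorem Expr.eval_two : (2 : Expr R A).eval σ = 2 := rfl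

@[simp] theorem Expr.cost_const (z : ℤ) : (Expr.const z : Expr R A).cost = 1 := rfl
@[simp] theorem Expr.cost_reg (r : R) : (Expr.reg r : Expr R A).cost = 1 := rfl
@[simp] theorem Expr.cost_cell (a : A) (x : Expr R A) : (Expr.cell a x).cost = x.cost + 1 := rfl
@[simp] theorem Expr.cost_add (x y : Expr R A) : (x + y).cost = x.cost + y.cost + 1 := rfl
@[simp] theorem Expr.cost_sub (x y : Expr R A) : (x - y).cost = x.cost + y.cost + 1 := rfl
@[simp] theorem Expr.cost_zero : (0 : Expr R A).cost = 1 := rfl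
@[simp] theorem Expr.cost_one : (1 : Expr R A).cost = 1 := rfl
@[simp] theorem Expr.cost_two : (2 : Expr R A).cost = 1 := rfl

@[simp] theorem State.setReg_reg [DecidableEq R] (r : R) (z : ℤ) (r' : R) :
    (σ.setReg r z).reg r' = if r' = r then z else σ.reg r' := by
  simp [State.setReg, Function.update_apply]

@[simp] theorem State.setReg_arr [DecidableEq R] (r : R) (z : ℤ) : (σ.setReg r z).arr = σ.arr := rfl

@[simp] theorem State.setCell_reg [DecidableEq A] (a : A) (i z : ℤ) : (σ.setCell a i z).reg = σ.reg := rfl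

@[simp] theorem State.setCell_arr [DecidableEq A] (a a' : A) (i z : ℤ) :
    (σ.setCell a i z).arr a' = if a' = a then Function.update (σ.arr a) i z else σ.arr a' := by
  simp only [State.setCell, Function.update_apply]

end Expressions

/-! ### Proof rules for total correctness with running time. -/

section Runs

variable {R A : Type} [DecidableEq R] [DecidableEq A] {σ : State R A} {Q Q' : ℕ → State R A → Prop}
  {s s' : Stmt R A} {c : Cond R A} {r : R} {l : List (Stmt R A)}

/-- The program `s`, started with memory `σ`, halts after some time and with some memory
that satisfy `Q`. -/
def Runs (s : Stmt R A) (σ : State R A) (Q : ℕ → State R A → Prop) : Prop :=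
  ∃ k σ', Exec s σ k σ' ∧ Q k σ'

theorem Runs.mono (h : Runs s σ Q) (hQ : ∀ k σ', Q k σ' → Q' k σ') : Runs s σ Q' := by
  obtain ⟨k, σ', he, hq⟩ := h
  exact ⟨k, σ', he, hQ k σ' hq⟩

theorem Runs.skip (h : Q 1 σ) : Runs .skip σ Q := ⟨_, _, .skip σ, h⟩

theorem Runs.assign {x : Expr R A} (h : Q (x.cost + 1) (σ.setReg r (x.eval σ))) :
    Runs (.assign r x) σ Q := ⟨_, _, .assign σ r x, h⟩

theorem Runs.store {a : A} {y x : Expr R A}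
    (h : Q (y.cost + x.cost + 1) (σ.setCell a (y.eval σ) (x.eval σ))) :
    Runs (.store a y x) σ Q := ⟨_, _, .store σ a y x, h⟩

theorem Runs.seq (h : Runs s σ fun k σ' => Runs s' σ' fun k' σ'' => Q (k + k') σ'') :
    Runs (.seq s s') σ Q := by
  obtain ⟨k, σ', he, k', σ'', he', hq⟩ := h
  exact ⟨_, _, .seq he he', hq⟩

theorem Runs.block_nil (h : Q 1 σ) : Runs (block []) σ Q := Runs.skip h

theorem Runs.block_cons
    (h : Runs s σ fun k σ' => Runs (block l) σ' fun k' σ'' => Q (k + k') σ'') :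
    Runs (block (s :: l)) σ Q := Runs.seq h

theorem Runs.branch (h₁ : c.Holds σ → Runs s σ fun k σ' => Q (c.cost + k) σ')
    (h₂ : ¬ c.Holds σ → Runs s' σ fun k σ' => Q (c.cost + k) σ') : Runs (.branch c s s') σ Q := by
  by_cases hc : c.Holds σ
  · obtain ⟨k, σ', he, hq⟩ := h₁ hc
    exact ⟨_, _, .branch_true hc he, hq⟩
  · obtain ⟨k, σ', he, hq⟩ := h₂ hc
    exact ⟨_, _, .branch_false hc he, hq⟩

theorem Runs.when (h₁ : c.Holds σ → Runs s σ fun k σ' => Q (c.cost + k) σ')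
    (h₂ : ¬ c.Holds σ → Q (c.cost + 1) σ) : Runs (when c s) σ Q :=
  Runs.branch h₁ fun h => Runs.skip (h₂ h)

/-- The rule for loops. `I d k σ` is the invariant when `d` more rounds will be made and the time
`k` has been spent. -/
theorem Runs.loop (I : ℕ → ℕ → State R A → Prop) {d k₀ : ℕ} (h : I d k₀ σ)
    (hstep : ∀ d k σ, I (d + 1) k σ →
      c.Holds σ ∧ Runs s σ fun k' σ' => I d (k + c.cost + k') σ')
    (hend : ∀ k σ, I 0 k σ → ¬ c.Holds σ) :
    Runs (.loop c s) σ fun k' σ' => ∃ k, k₀ + k' = k + c.cost ∧ I 0 k σ' := by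
  induction d generalizing k₀ σ with
  | zero => exact ⟨_, _, .loop_false (hend _ _ h), k₀, rfl, h⟩
  | succ d ih =>
    obtain ⟨hc, k, σ', he, hI⟩ := hstep _ _ _ h
    obtain ⟨k', σ'', he', k'', hk, hI'⟩ := ih hI
    exact ⟨_, _, .loop_true hc he he', k'', by omega, hI'⟩


/-- The rule for `forUp`. `I z k σ` is the invariant before the round for `z`, where the time `k`
has been spent since the start. -/
theorem Runs.forUp {lo hi : Expr R A} (I : ℕ → ℕ → State R A → Prop) {a b : ℕ}
    (hlo : lo.eval σ = a) (hab : a ≤ b) (h₀ : I a (lo.cost + 1) (σ.setReg r a))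
    -- With `b` one past the end, an empty range with `hi = -1` is covered by natural numbers.
    (hhi : ∀ z k σ, I z k σ → σ.reg r = z → hi.eval σ + 1 = b)
    (hstep : ∀ z k σ, a ≤ z → z < b → I z k σ → σ.reg r = z → Runs s σ fun k' σ' =>
      σ'.reg r = z ∧ I (z + 1) (k + k' + hi.cost + 7) (σ'.setReg r ((z + 1 : ℕ) : ℤ))) :
    Runs (forUp r lo hi s) σ fun k σ' =>
      ∃ k₀, k = k₀ + hi.cost + 3 ∧ σ'.reg r = b ∧ I b k₀ σ' := by
  refine Runs.block_cons (Runs.assign (Runs.block_cons ?_))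
  rw [hlo]
  refine Runs.mono (Runs.loop
    (fun d k σ => ∃ z, a ≤ z ∧ z + d = b ∧ σ.reg r = z ∧ I z k σ)
    (d := b - a) (k₀ := lo.cost + 1) ⟨a, le_rfl, by omega, by simp, h₀⟩ ?_ ?_) ?_
  · rintro d k σ ⟨z, haz, hzb, hr, hI⟩
    have hh := hhi z k σ hI hr
    constructor
    · simp only [Cond.Holds, Expr.eval_reg]
      omega
    · refine Runs.block_cons (Runs.mono (hstep z k σ haz (by omega) hI hr) ?_)
      rintro k' σ' ⟨hr', hI'⟩
      -- The overhead `hi.cost + 7` of a round is `hi.cost + 2` for the test, 4 for the increment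
      -- and 1 for the end of the block.
      refine Runs.block_cons (Runs.assign (Runs.block_nil ⟨z + 1, by omega, by omega, ?_, ?_⟩))
      · simp [hr']
      · have hz : (z : ℤ) + 1 = ((z + 1 : ℕ) : ℤ) := by push_cast; rfl
        simp only [Expr.eval_add, Expr.eval_reg, hr', Expr.eval_one, Cond.cost, Expr.cost_reg,
          Expr.cost_add, Expr.cost_one, hz]
        convert hI' using 1
        omega
  · rintro k σ ⟨z, haz, hzb, hr, hI⟩
    have hh := hhi z k σ hI hr
    simp only [Cond.Holds, Expr.eval_reg]
    omega
  · rintro k σ' ⟨k₀, hk, z, haz, hzb, hr, hI⟩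
    obtain rfl : z = b := by omega
    refine Runs.block_nil ⟨k₀, ?_, hr, hI⟩
    simp only [Cond.cost, Expr.cost_reg] at hk
    omega

/-- The rule for `forDown`. `I z k σ` is the invariant before the round for `z`, where the time `k`
has been spent since the start. -/
theorem Runs.forDown {lo hi : Expr R A} (I : ℕ → ℕ → State R A → Prop) {b : ℕ}
    (hhi : hi.eval σ = b) (h₀ : I b (hi.cost + 1) (σ.setReg r b))
    (hlo : ∀ z k σ, I z k σ → σ.reg r = z → lo.eval σ = 1)
    (hstep : ∀ z k σ, z < b → I (z + 1) k σ → σ.reg r = ((z + 1 : ℕ) : ℤ) →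
      Runs s σ fun k' σ' => σ'.reg r = ((z + 1 : ℕ) : ℤ) ∧
        I z (k + k' + lo.cost + 7) (σ'.setReg r z)) :
    Runs (forDown r hi lo s) σ fun k σ' => ∃ k₀, k = k₀ + lo.cost + 3 ∧ I 0 k₀ σ' := by
  refine Runs.block_cons (Runs.assign (Runs.block_cons ?_))
  rw [hhi]
  refine Runs.mono (Runs.loop (fun d k σ => d ≤ b ∧ σ.reg r = d ∧ I d k σ)
    (d := b) (k₀ := hi.cost + 1) ⟨le_rfl, by simp, h₀⟩ ?_ ?_) ?_
  · rintro d k σ ⟨hd, hr, hI⟩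
    have hh := hlo _ k σ hI hr
    constructor
    · simp only [Cond.Holds, Expr.eval_reg]
      omega
    · refine Runs.block_cons (Runs.mono (hstep d k σ (by omega) hI hr) ?_)
      rintro k' σ' ⟨hr', hI'⟩
      refine Runs.block_cons (Runs.assign (Runs.block_nil ⟨by omega, ?_, ?_⟩))
      · simp [hr']
      · have hz : (((d + 1 : ℕ) : ℤ) - 1) = d := by omega
        simp only [Expr.eval_sub, Expr.eval_reg, hr', Expr.eval_one, Cond.cost, Expr.cost_reg,
          Expr.cost_sub, Expr.cost_one, hz]
        convert hI' using 1
        omega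
  · rintro k σ ⟨-, hr, hI⟩
    have hh := hlo _ k σ hI hr
    simp only [Cond.Holds, Expr.eval_reg]
    omega
  · rintro k σ' ⟨k₀, hk, -, hr, hI⟩
    refine Runs.block_nil ⟨k₀, ?_, hI⟩
    simp only [Cond.cost, Expr.cost_reg] at hk
    omega

end Runs

/-! ### Finite sets in memory -/

section Memory

variable {n m C N : ℕ} {T M : ℕ → Finset ℕ} {σ σ' : State Reg Arr} {a a' : ℤ → ℤ} {s s' : ℤ}
  {S : Finset ℕ}

/-- Since `#S` cells take `#S` different values, no value is repeated. -/
theorem lists_iff : Lists a s S ↔ ∃ f : ℕ → ℕ, (∀ k < #S, a (s + (k : ℤ)) = f k) ∧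
    Set.InjOn f (range #S) ∧ (range #S).image f = S := by
  constructor
  · intro h
    have hc : #((range #S).image fun k : ℕ => a (s + (k : ℤ))) = #(range #S) := by
      rw [h, card_image_of_injective _ Nat.cast_injective, card_range]
    have hinj := card_image_iff.1 hc
    have hf : ∀ k < #S, a (s + (k : ℤ)) = ((a (s + (k : ℤ))).toNat : ℤ) := by
      intro k hk
      have : a (s + (k : ℤ)) ∈ S.image fun t : ℕ => (t : ℤ) := by
        rw [← h]
        exact mem_image_of_mem _ (mem_range.2 hk)
      obtain ⟨t, -, ht⟩ := mem_image.1 this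
      rw [← ht]
      simp
    refine ⟨fun k => (a (s + (k : ℤ))).toNat, hf, fun k hk k' hk' hkk => hinj hk hk' ?_, ?_⟩
    · simp only [coe_range, Set.mem_Iio] at hk hk'
      simp only at hkk ⊢
      rw [hf k hk, hf k' hk', hkk]
    · refine image_injective (Nat.cast_injective (R := ℤ)) ?_
      change image _ _ = S.image fun t : ℕ => (t : ℤ)
      rw [← h, image_image]
      refine image_congr fun k hk => ?_
      simp only [coe_range, Set.mem_Iio] at hk
      exact (hf k hk).symm
  · rintro ⟨f, hf, -, hS⟩
    rw [Lists]
    conv_rhs => rw [← hS]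
    rw [image_image]
    refine image_congr fun k hk => ?_
    simp only [coe_range, Set.mem_Iio] at hk
    exact hf k hk

theorem Lists.congr (h : Lists a s S) (ha : ∀ k < #S, a' (s' + (k : ℤ)) = a (s + (k : ℤ))) :
    Lists a' s' S := by
  rw [Lists] at h ⊢
  rw [← h]
  refine image_congr fun k hk => ?_
  simp only [coe_range, Set.mem_Iio] at hk
  exact ha k hk

theorem Lists.insert (h : Lists a s S) {t : ℕ} (ht : t ∉ S) :
    Lists (Function.update a (s + #S) t) s (insert t S) := by
  rw [Lists] at h ⊢
  rw [card_insert_of_notMem ht, range_add_one, image_insert, image_insert, ← h,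
    Function.update_self]
  congr 1
  refine image_congr fun k hk => ?_
  simp only [coe_range, Set.mem_Iio] at hk
  rw [Function.update_of_ne]
  omega

/-- The memory contains the magazine states `M 1, …, M N`. -/
def Stored (C N : ℕ) (M : ℕ → Finset ℕ) (σ : State Reg Arr) : Prop :=
  ∀ i ∈ Icc 1 N, σ.arr .base i = ((i : ℤ) - 1) * C ∧ σ.arr .card i = #(M i) ∧
    Lists (σ.arr .mag) (((i : ℤ) - 1) * C) (M i)

theorem Stored.congr (h : Stored C N M σ) (h₁ : σ'.arr .base = σ.arr .base)
    (h₂ : σ'.arr .card = σ.arr .card) (h₃ : σ'.arr .mag = σ.arr .mag) : Stored C N M σ' := by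
  intro i hi
  rw [h₁, h₂, h₃]
  exact h i hi

theorem IsInput.congr (h : IsInput n m C T σ) (h₁ : σ'.reg .n = σ.reg .n)
    (h₂ : σ'.reg .m = σ.reg .m) (h₃ : σ'.reg .C = σ.reg .C) (h₄ : σ'.arr .len = σ.arr .len)
    (h₅ : σ'.arr .inp = σ.arr .inp) : IsInput n m C T σ' where
  reg_n := h₁ ▸ h.reg_n
  reg_m := h₂ ▸ h.reg_m
  reg_C := h₃ ▸ h.reg_C
  len := h₄ ▸ h.len
  inp := h₅ ▸ h.inp

/-- Cells of different magazine states are different. -/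
theorem slot_ne {i j k l : ℕ} (hij : i ≠ j) (hk : k < C) (hl : l < C) :
    ((i : ℤ) - 1) * C + k ≠ ((j : ℤ) - 1) * C + l := by
  intro h
  rcases Nat.lt_or_gt_of_ne hij with hlt | hlt
  · have : ((i : ℤ) + 1) * C ≤ j * C := by gcongr; omega
    nlinarith
  · have : ((j : ℤ) + 1) * C ≤ i * C := by gcongr; omega
    nlinarith

/-- The last clause lets one magazine state be read while another one grows. -/
theorem runs_append {r : Reg} {i t : ℕ} (h : Stored C N M σ) (hr : σ.reg r = i)
    (hi : i ∈ Icc 1 N) (ht : σ.reg .t = t) (htM : t ∉ M i) (hC : ∀ j ∈ Icc 1 N, #(M j) ≤ C)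
    (hlt : #(M i) < C) :
    Runs (append r) σ fun k σ' => k ≤ 20 ∧ σ'.reg = σ.reg ∧
      (∀ a, a ≠ .mag → a ≠ .card → σ'.arr a = σ.arr a) ∧
      Stored C N (Function.update M i (insert t (M i))) σ' ∧
      ∀ j k : ℕ, j ≠ i → k < C →
        σ'.arr .mag (((j : ℤ) - 1) * C + k) = σ.arr .mag (((j : ℤ) - 1) * C + k) := by
  obtain ⟨hb, hc, hl⟩ := h i hi
  refine Runs.block_cons (Runs.store (Runs.block_cons (Runs.store (Runs.block_nil
    ⟨by simp, by simp, fun a h₁ h₂ => by simp [h₁, h₂], fun j hj => ?_, fun j k hj hk => ?_⟩))))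
  swap
  · simp [hr, hb, hc, Function.update_of_ne (slot_ne hj hk hlt)]
  obtain ⟨hb', hc', hl'⟩ := h j hj
  simp only [Expr.eval_add, Expr.eval_cell, Expr.eval_reg, hr, hb, hc, ht, State.setCell_reg,
    State.setCell_arr, reduceCtorEq, if_true, if_false, Expr.eval_one]
  rcases eq_or_ne j i with rfl | hij
  · simp only [Function.update_self, card_insert_of_notMem htM]
    exact ⟨hb, by push_cast; rfl, hl.insert htM⟩
  · rw [Function.update_of_ne hij, Function.update_of_ne (by exact_mod_cast hij)]
    refine ⟨hb', hc', hl'.congr fun k hk => ?_⟩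
    rw [Function.update_of_ne]
    exact slot_ne hij (hk.trans_le (hC j hj)) hlt

end Memory

/-! ### Initialisation loops. -/

section Loops

variable {n m C N : ℕ} {T M : ℕ → Finset ℕ} {σ : State Reg Arr} {S : Finset ℕ}

/-- Setting all cells of an array that belong to tools to the same value. -/
theorem runs_fill (a : Arr) (z : ℤ) (hm : σ.reg .m = m) :
    Runs (forUp .t 1 (v .m) (.store a (v .t) (.const z))) σ fun k σ' =>
      k ≤ 20 * m + 30 ∧ (∀ r, r ≠ .t → σ'.reg r = σ.reg r) ∧
      (∀ a', a' ≠ a → σ'.arr a' = σ.arr a') ∧ ∀ t ∈ Icc 1 m, σ'.arr a (t : ℕ) = z := by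
  refine Runs.mono (Runs.forUp (fun i k σ' => k ≤ 20 * i ∧
    (∀ r, r ≠ .t → σ'.reg r = σ.reg r) ∧ (∀ a', a' ≠ a → σ'.arr a' = σ.arr a') ∧
    ∀ t, 1 ≤ t → t < i → σ'.arr a (t : ℕ) = z) (a := 1) (b := m + 1) (by simp) (by omega)
    ⟨by simp, fun r hr => by simp [hr], by simp, by omega⟩ ?_ ?_) ?_
  · rintro i k σ' ⟨-, hr, -⟩ -
    simp [hr, hm]
  · rintro i k σ' hi - ⟨hk, hr, ha, ht⟩ hi'
    refine Runs.store ⟨by simp [hi'], by simp; omega, fun r hr' => by simp [hr', hr],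
      fun a' ha' => by simp [ha', ha], fun t h₁ h₂ => ?_⟩
    simp only [State.setReg_arr, State.setCell_arr, if_true, Expr.eval_reg, Expr.eval_const, hi',
      Function.update_apply, Nat.cast_inj]
    split_ifs with hti
    · rfl
    · exact ht t h₁ (by omega)
  · rintro k σ' ⟨k₀, rfl, -, hk, hr, ha, ht⟩
    simp only [mem_Icc]
    exact ⟨by simp; omega, hr, ha, fun t h => ht t h.1 (by omega)⟩

/-- Marking the elements of a set that is listed in memory. -/
theorem runs_mark (a : Arr) (z : ℤ) {hi x : Expr Reg Arr} {f : ℕ → ℕ}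
    (hS : (range #S).image f = S)
    -- Both expressions are evaluated anew in every round, so they must not depend on the array
    -- being written.
    (hx : ∀ σ' : State Reg Arr, (∀ r, r ≠ .k → σ'.reg r = σ.reg r) →
      (∀ a', a' ≠ a → σ'.arr a' = σ.arr a') → hi.eval σ' + 1 = #S ∧
      ∀ k < #S, σ'.reg .k = k → x.eval σ' = f k) :
    Runs (forUp .k 0 hi (.store a x (.const z))) σ fun k σ' =>
      k ≤ (x.cost + hi.cost + 9) * (#S + 1) ∧ (∀ r, r ≠ .k → σ'.reg r = σ.reg r) ∧
      (∀ a', a' ≠ a → σ'.arr a' = σ.arr a') ∧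
      ∀ t : ℕ, σ'.arr a t = if t ∈ S then z else σ.arr a t := by
  refine Runs.mono (Runs.forUp (fun i k σ' => k ≤ (x.cost + hi.cost + 9) * i + 2 ∧
    (∀ r, r ≠ .k → σ'.reg r = σ.reg r) ∧ (∀ a', a' ≠ a → σ'.arr a' = σ.arr a') ∧
    ∀ t : ℕ, σ'.arr a t = if t ∈ (range i).image f then z else σ.arr a t) (a := 0) (b := #S)
    (by simp) (by omega)
    ⟨by simp, fun r hr => by simp [hr], by simp, by simp⟩ ?_ ?_) ?_
  · rintro i k σ' ⟨-, hr, ha, -⟩ -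
    exact (hx σ' hr ha).1
  · rintro i k σ' - hi' ⟨hk, hr, ha, ht⟩ hi''
    refine Runs.store ⟨by simp [hi''], ?_, fun r hr' => by simp [hr', hr],
      fun a' ha' => by simp [ha', ha], fun t => ?_⟩
    · rw [Expr.cost_const, Nat.mul_succ]
      omega
    · simp only [State.setReg_arr, State.setCell_arr, if_true, (hx σ' hr ha).2 i hi' hi'',
        Expr.eval_const, Function.update_apply, Nat.cast_inj, range_add_one, image_insert,
        mem_insert, ht t]
      by_cases htf : t = f i <;> simp [htf]
  · rintro k σ' ⟨k₀, rfl, -, hk, hr, ha, ht⟩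
    rw [hS] at ht
    refine ⟨?_, hr, ha, ht⟩
    rw [Nat.mul_succ]
    omega

/-- Copying a block of memory from the input to the magazine states. -/
theorem runs_copy {i l : ℕ} (hi : σ.reg .i = i) (hl : σ.arr .len i = l) :
    Runs (forUp .k 0 (.cell .len (v .i) - 1) (block [
        .store .mag (v .b + v .k) (.cell .inp (v .p)),
        .assign .p (v .p + 1)])) σ fun k σ' =>
      k ≤ 40 * l + 20 ∧ (∀ r, r ≠ .k → r ≠ .p → σ'.reg r = σ.reg r) ∧
      (∀ a, a ≠ .mag → σ'.arr a = σ.arr a) ∧ σ'.reg .p = σ.reg .p + l ∧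
      (∀ k : ℕ, k < l → σ'.arr .mag (σ.reg .b + k) = σ.arr .inp (σ.reg .p + k)) ∧
      ∀ y, y < σ.reg .b → σ'.arr .mag y = σ.arr .mag y := by
  refine Runs.mono (Runs.forUp (fun z k σ' => k ≤ 40 * z + 2 ∧
    (∀ r, r ≠ .k → r ≠ .p → σ'.reg r = σ.reg r) ∧
      (∀ a, a ≠ .mag → σ'.arr a = σ.arr a) ∧ σ'.reg .p = σ.reg .p + z ∧
      (∀ k : ℕ, k < z → σ'.arr .mag (σ.reg .b + k) = σ.arr .inp (σ.reg .p + k)) ∧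
      ∀ y, y < σ.reg .b → σ'.arr .mag y = σ.arr .mag y) (a := 0) (b := l)
    (by simp) (by omega)
    ⟨by simp, fun r hr _ => by simp [hr], by simp, by simp, by simp, by simp⟩ ?_ ?_) ?_
  · rintro z k σ' ⟨-, hr, ha, -⟩ -
    simp [hr, ha, hi, hl]
  · rintro z k σ' - hz ⟨hk, hr, ha, hp, hc, hb⟩ hz'
    refine Runs.block_cons (Runs.store (Runs.block_cons (Runs.assign (Runs.block_nil
      ⟨by simp [hz'], by simp; omega, fun r h₁ h₂ => by simp [h₁, h₂, hr],
        fun a h => by simp [h, ha], by simp [hp]; ring, fun k' hk' => ?_, fun y hy => ?_⟩))))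
    · simp only [State.setReg_arr, State.setCell_arr, if_true, Expr.eval_add, Expr.eval_reg,
        Expr.eval_cell, hr .b (by simp) (by simp), hz', hp, ha .inp (by simp)]
      rcases eq_or_ne k' z with rfl | hne
      · simp
      · rw [Function.update_of_ne (by omega)]
        exact hc k' (by omega)
    · simp only [State.setReg_arr, State.setCell_arr, if_true, Expr.eval_add, Expr.eval_reg,
        hr .b (by simp) (by simp), hz']
      rw [Function.update_of_ne (by omega)]
      exact hb y hy
  · rintro k σ' ⟨k₀, rfl, -, hk, h⟩
    exact ⟨by simp; omega, h⟩

/-- Storing the tool sets as magazine states. -/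
theorem runs_init (h : IsInput n m C T σ) (hC : ∀ i ∈ Icc 1 n, #(T i) ≤ C)
    (htotal : σ.reg .total = 0) (hp : σ.reg .p = 0) (hb : σ.reg .b = 0) :
    Runs (forUp .i 1 (v .n) (block [
      .store .base (v .i) (v .b),
      .store .card (v .i) (.cell .len (v .i)),
      .assign .total (v .total + .cell .len (v .i)),
      forUp .k 0 (.cell .len (v .i) - 1) (block [
        .store .mag (v .b + v .k) (.cell .inp (v .p)),
        .assign .p (v .p + 1)]),
      .assign .b (v .b + v .C)])) σ fun k σ' =>
      k ≤ 40 * (∑ i ∈ Icc 1 n, #(T i)) + 60 * n + 80 ∧ IsInput n m C T σ' ∧ Stored C n T σ' ∧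
      σ'.reg .total = ∑ i ∈ Icc 1 n, (#(T i) : ℤ) ∧ σ'.reg .pipesCount = σ.reg .pipesCount ∧
      σ'.reg .lastFull = σ.reg .lastFull ∧ σ'.arr .lastSeen = σ.arr .lastSeen := by
  refine Runs.mono (Runs.forUp (fun z k σ' =>
      k ≤ 40 * (∑ i ∈ Ico 1 z, #(T i)) + 60 * z ∧ IsInput n m C T σ' ∧ Stored C (z - 1) T σ' ∧
      σ'.reg .total = ∑ i ∈ Ico 1 z, (#(T i) : ℤ) ∧ σ'.reg .p = ∑ i ∈ Ico 1 z, (#(T i) : ℤ) ∧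
      σ'.reg .b = ((z : ℤ) - 1) * C ∧ σ'.reg .pipesCount = σ.reg .pipesCount ∧
      σ'.reg .lastFull = σ.reg .lastFull ∧ σ'.arr .lastSeen = σ.arr .lastSeen)
      (a := 1) (b := n + 1) (by simp) (by omega) ⟨by simp, h.congr (by simp) (by simp) (by simp)
        (by simp) (by simp), by simp [Stored], by simp [htotal], by simp [hp], by simp [hb],
        by simp, by simp, by simp⟩ ?_ ?_) ?_
  · rintro z k σ' ⟨-, h, -⟩ -
    simp [h.reg_n]
  · rintro z k σ' hz hzn ⟨hk, h, hst, htot, hp, hb, hpc, hlf, hls⟩ hi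
    have hlen := h.len z (by simp; omega)
    refine Runs.block_cons (Runs.store (Runs.block_cons (Runs.store (Runs.block_cons (Runs.assign
      (Runs.block_cons (Runs.mono (runs_copy (i := z) (l := #(T z)) (by simp [hi]) (by simp [hlen]))
      ?_)))))))
    rintro k' σ₁ ⟨hk', hr, ha, hp', hc, hbefore⟩
    refine Runs.block_cons (Runs.assign (Runs.block_nil ?_))
    simp only [State.setReg_reg, State.setReg_arr, State.setCell_reg, State.setCell_arr,
      reduceCtorEq, if_false, hp, hb] at hp' hc hbefore
    have hb' : σ₁.reg .b = ((z : ℤ) - 1) * C := by rw [hr _ (by simp) (by simp)]; simp [hb]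
    have hC' : σ₁.reg .C = C := by rw [hr _ (by simp) (by simp)]; simp [h.reg_C]
    have hbase : σ₁.arr .base = Function.update (σ'.arr .base) z (((z : ℤ) - 1) * C) := by
      rw [ha _ (by simp)]; simp [hi, hb]
    have hcard : σ₁.arr .card = Function.update (σ'.arr .card) z #(T z) := by
      rw [ha _ (by simp)]; simp [hi, hlen]
    refine ⟨?_, ?_, h.congr ?_ ?_ ?_ ?_ ?_, ?_, ?_, ?_, ?_, ?_, ?_, ?_⟩
    · simp [hr, hi]
    · rw [sum_Ico_succ_top hz]
      simp
      omega
    · simp [hr]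
    · simp [hr]
    · simp [hr]
    · simp [ha]
    · simp [ha]
    · intro j hj
      have hj := mem_Icc.1 hj
      simp only [State.setReg_arr, hbase, hcard]
      rcases eq_or_ne j z with rfl | hjz
      · simp only [Function.update_self, true_and]
        exact (h.inp j (by simp; omega)).congr fun k hk => hc k hk
      · rw [Function.update_of_ne (by exact_mod_cast hjz),
          Function.update_of_ne (by exact_mod_cast hjz)]
        obtain ⟨h₁, h₂, h₃⟩ := hst j (by simp; omega)
        -- Blocks are written by increasing address, so the block of `j < z` lies below the cells
        -- written now.
        refine ⟨h₁, h₂, h₃.congr fun k hk => hbefore _ ?_⟩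
        have := hC j (by simp; omega)
        have : (j : ℤ) * C ≤ ((z : ℤ) - 1) * C := by gcongr; omega
        have : (k : ℤ) < C := by omega
        linarith
    · rw [sum_Ico_succ_top hz]
      simp [hr, htot, hi, hlen]
    · rw [sum_Ico_succ_top hz]
      simp [hp']
    · simp [hb', hC']
      ring
    · simp [hr, hpc]
    · simp [hr, hlf]
    · simp [ha, hls]
  · rintro k σ' ⟨k₀, rfl, -, hk, h, hst, htot, -, -, hpc, hlf, hls⟩
    rw [← Ico_add_one_right_eq_Icc]
    exact ⟨by simp; omega, h, hst, htot, hpc, hlf, hls⟩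

end Loops

/-! ### Correctness and amortised running time of GPCA. -/

section Gpca

variable {n m C : ℕ} {T M : ℕ → Finset ℕ} {e f cnt t : ℕ} {D : Finset ℕ} {σ : State Reg Arr}

/-- The memory agrees with the abstract state of the greedy pipe construction. -/
structure GpcaState (n m C : ℕ) (T : ℕ → Finset ℕ) (e : ℕ) (D : Finset ℕ) (M : ℕ → Finset ℕ)
    (f cnt : ℕ) (pos : ℤ) (σ : State Reg Arr) : Prop where
  input : IsInput n m C T σ
  stored : Stored C n M σ
  -- The value `-1` makes the test `lastFull ≤ lastSeen[t]` fail for a first use even when `lastFull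
  -- = 0`.
  seen : ∀ t ∈ Icc 1 m, σ.arr .lastSeen (t : ℕ) =
    if t ∈ D then (e : ℤ) else if prev T t e = 0 then -1 else (prev T t e : ℤ)
  lastFull : σ.reg .lastFull = f
  pipesCount : σ.reg .pipesCount = cnt
  total : σ.reg .total = ∑ i ∈ Icc 1 n, (#(T i) : ℤ)
  pos : σ.reg .p = pos

theorem pipe_self {s : ℕ} : pipe M t s (s + 1) = M := by
  funext i
  rw [pipe, if_neg (by omega)]

theorem pipe_succ {s e : ℕ} (h : s < e) :
    pipe M t s (e + 1) = Function.update (pipe M t s e) e (insert t (pipe M t s e e)) := by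
  funext i
  rcases eq_or_ne i e with rfl | hi
  · rw [Function.update_self, pipe, pipe, if_pos (by omega), if_neg (by omega)]
  · rw [Function.update_of_ne hi, pipe, pipe]
    congr 1
    apply propext
    omega

/-- A pipe raises the potential by its length, which pays for the time spent on building it. -/
theorem sum_card_add_le_pipe {s : ℕ} (hs : 1 ≤ s) (he : e ≤ n + 1)
    (ht : ∀ i, s < i → i < e → t ∉ M i) :
    ∑ i ∈ Icc 1 n, #(M i) + (e - s - 1) ≤ ∑ i ∈ Icc 1 n, #(pipe M t s e i) := by
  have h₁ : ∀ i ∈ Icc 1 n, #(M i) + (if i ∈ Ioo s e then 1 else 0) ≤ #(pipe M t s e i) := by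
    intro i _
    rw [pipe]
    by_cases hi : s < i ∧ i < e
    · rw [if_pos hi, if_pos (mem_Ioo.2 hi), card_insert_of_notMem (ht i hi.1 hi.2)]
    · rw [if_neg hi, if_neg (by rwa [mem_Ioo])]
      simp
  have h₂ := sum_le_sum h₁
  have h₃ : Icc 1 n ∩ Ioo s e = Ioo s e := by
    ext i
    simp
    omega
  rwa [sum_add_distrib, sum_ite_mem, h₃, sum_const, Nat.card_Ioo, smul_eq_mul, mul_one] at h₂

/-- Building one pipe. -/
theorem runs_pipe {pos : ℤ} (hg : GreedyInv n m C T e D M f cnt) (hσ : GpcaState n m C T e D M f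
    cnt pos σ) (hn : e ≤ n) (htm : t ∈ Icc 1 m) (hD : t ∉ D) (he : σ.reg .e = e)
    (ht : σ.reg .t = t) (hp : prev T t e ≠ 0) (hf : f ≤ prev T t e) {cnt' : ℤ} :
    Runs (forUp .i (.cell .lastSeen (v .t) + 1) (v .e - 1) (block [
        append .i,
        when (.eq (.cell .card (v .i)) (v .C)) (.assign .lastFull (v .i))]))
      (σ.setReg .pipesCount cnt') fun k σ' =>
      k ≤ 60 * (e - prev T t e - 1) + 40 ∧
      (∀ r, r ≠ .i → r ≠ .lastFull → r ≠ .pipesCount → σ'.reg r = σ.reg r) ∧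
      σ'.reg .pipesCount = cnt' ∧
      (∀ a, a ≠ .mag → a ≠ .card → σ'.arr a = σ.arr a) ∧
      Stored C n (pipe M t (prev T t e) e) σ' ∧
      ∃ f' : ℕ, σ'.reg .lastFull = f' ∧ f' < e ∧ (f' ≠ 0 → #(pipe M t (prev T t e) e f') = C) ∧
        ∀ i, 2 ≤ i → f' < i → i < e → #(pipe M t (prev T t e) e i) < C := by
  have hlt : prev T t e < e := prev_lt (by have := hg.two_le; omega)
  have hseen : σ.arr .lastSeen t = (prev T t e : ℤ) := by
    rw [hσ.seen t htm, if_neg hD, if_neg hp]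
  have hfresh : ∀ i, prev T t e < i → i < e → t ∉ M i := fun i => hg.fresh t i hD
  have hnf := hg.not_full
  have hff := hg.full
  have hcard := hg.card_le
  generalize prev T t e = s at *
  have hpcard : ∀ z i, s < i → i < e → i < z → #(pipe M t s z i) = #(M i) + 1 := by
    intro z i h₁ h₂ h₃
    rw [pipe, if_pos ⟨h₁, h₃⟩, card_insert_of_notMem (hfresh i h₁ h₂)]
  have hpcard' : ∀ z i, ¬ (s < i ∧ i < z) → pipe M t s z i = M i := fun z i h => if_neg h
  refine Runs.mono (Runs.forUp (fun z k σ' => k + 60 * (s + 1) ≤ 60 * z + 6 ∧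
      (∀ r, r ≠ .i → r ≠ .lastFull → r ≠ .pipesCount → σ'.reg r = σ.reg r) ∧
      σ'.reg .pipesCount = cnt' ∧
      (∀ a, a ≠ .mag → a ≠ .card → σ'.arr a = σ.arr a) ∧
      Stored C n (pipe M t s z) σ' ∧
      ∃ f' : ℕ, σ'.reg .lastFull = f' ∧ f' < z ∧ (f' ≠ 0 → #(pipe M t s z f') = C) ∧
        ∀ i, 2 ≤ i → f' < i → i < z → #(pipe M t s z i) < C) (a := s + 1) (b := e)
    (by simp [ht, hseen]) (by omega) ⟨?_, ?_, ?_, ?_, ?_, f, ?_, ?_, ?_, ?_⟩ ?_ ?_) ?_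
  · simp
    omega
  · intro r h₁ h₂ h₃
    simp [h₁, h₃]
  · simp
  · simp
  · rw [pipe_self]
    exact hσ.stored.congr (by simp) (by simp) (by simp)
  · simp [hσ.lastFull]
  · omega
  · rwa [pipe_self]
  · rw [pipe_self]
    exact fun i h₁ h₂ h₃ => hnf i h₁ h₂ (by omega)
  · rintro z k σ' ⟨-, hr, -⟩ -
    simp [hr, he]
  · rintro z k σ' hsz hze ⟨hk, hr, hpc, ha, hst, f', hf', hfz, hfull, hnot⟩ hi
    have hMz : pipe M t s z z = M z := hpcard' z z (by omega)
    -- Job `z` lies beyond `s ≥ f`, so it still has a free slot.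
    have hz := hnf z (by omega) (by omega) hze
    refine Runs.block_cons (Runs.mono (runs_append (i := z) (t := t) hst hi (by simp; omega)
      (by rw [hr _ (by simp) (by simp) (by simp), ht]) (by rw [hMz]; exact hfresh z hsz hze)
      (fun j hj => ?_) (by rwa [hMz])) ?_)
    · by_cases hc : s < j ∧ j < z
      · have := hnf j (by omega) (by omega) (by omega)
        rw [hpcard z j hc.1 (by omega) hc.2]
        omega
      · rw [hpcard' z j hc]
        exact hcard j hj
    rintro k₁ σ₁ ⟨hk₁, hr₁, ha₁, hst₁, -⟩
    rw [← pipe_succ hsz] at hst₁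
    have hcz : σ₁.arr .card z = #(pipe M t s (z + 1) z) := (hst₁ z (by simp; omega)).2.1
    have hold : ∀ i, i < z → pipe M t s (z + 1) i = pipe M t s z i := by
      intro i hi
      rw [pipe_succ hsz, Function.update_of_ne (by omega)]
    have hCr : σ₁.reg .C = C := by
      rw [hr₁, hr _ (by simp) (by simp) (by simp), hσ.input.reg_C]
    have hle : #(pipe M t s (z + 1) z) ≤ C := by
      rw [hpcard _ z hsz hze (by omega)]
      omega
    refine Runs.block_cons (Runs.when (fun hc => Runs.assign (Runs.block_nil ?_))
      fun hc => Runs.block_nil ?_)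
    · simp only [Cond.Holds, Expr.eval_cell, Expr.eval_reg, hr₁, hi, hcz] at hc
      rw [← hr₁, hCr] at hc
      refine ⟨by simp [hr₁, hi], by simp [Cond.cost]; omega, ?_, by simp [hr₁, hpc], ?_,
        hst₁.congr (by simp) (by simp) (by simp), z, by simp [hr₁, hi], by omega,
        fun _ => by exact_mod_cast hc, fun i h₁ h₂ h₃ => by omega⟩
      · intro r h₁ h₂ h₃
        simp [h₁, h₂, hr₁, hr r h₁ h₂ h₃]
      · intro a h₁ h₂
        simp [ha₁ a h₁ h₂, ha a h₁ h₂]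
    · simp only [Cond.Holds, Expr.eval_cell, Expr.eval_reg, hr₁, hi, hcz] at hc
      rw [← hr₁, hCr] at hc
      refine ⟨by simp [hr₁, hi], by simp [Cond.cost]; omega, ?_, by simp [hr₁, hpc], ?_,
        hst₁.congr (by simp) (by simp) (by simp), f', by simp [hr₁, hf'], by omega,
        fun h => by rw [hold _ hfz]; exact hfull h, fun i h₁ h₂ h₃ => ?_⟩
      · intro r h₁ h₂ h₃
        simp [h₁, hr₁, hr r h₁ h₂ h₃]
      · intro a h₁ h₂
        simp [ha₁ a h₁ h₂, ha a h₁ h₂]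
      · rcases Nat.lt_or_ge i z with hiz | hiz
        · rw [hold i hiz]
          exact hnot i h₁ h₂ hiz
        · obtain rfl : i = z := by omega
          exact lt_of_le_of_ne hle (by exact_mod_cast hc)
  · rintro k σ' ⟨k₀, rfl, -, hk, hr, hpc, ha, hst, f', hf'⟩
    exact ⟨by simp; omega, hr, hpc, ha, hst, f', hf'⟩

/-- Considering the pipe that ends at job `e` with the tool `t`. -/
theorem runs_tool {pos : ℤ} (hg : GreedyInv n m C T e D M f cnt)
    (hσ : GpcaState n m C T e D M f cnt pos σ) (hn : e ≤ n) (htT : t ∈ T e) (hD : t ∉ D)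
    (he : σ.reg .e = e) (ht : σ.arr .inp pos = t) :
    Runs (block [
        .assign .t (.cell .inp (v .p)),
        .assign .p (v .p + 1),
        when (.le (v .lastFull) (.cell .lastSeen (v .t))) (block [
          .assign .pipesCount (v .pipesCount + 1),
          forUp .i (.cell .lastSeen (v .t) + 1) (v .e - 1) (block [
            append .i,
            when (.eq (.cell .card (v .i)) (v .C)) (.assign .lastFull (v .i))])]),
        .store .lastSeen (v .t) (v .e)]) σ fun k σ' =>
      σ'.reg .e = e ∧ σ'.reg .k = σ.reg .k ∧ σ'.arr .inp = σ.arr .inp ∧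
      ∃ M' f' cnt', GreedyInv n m C T e (insert t D) M' f' cnt' ∧
        GpcaState n m C T e (insert t D) M' f' cnt' (pos + 1) σ' ∧
        k + 60 * ∑ i ∈ Icc 1 n, #(M i) ≤ 60 * ∑ i ∈ Icc 1 n, #(M' i) + 80 := by
  have he2 := hg.two_le
  have htm : t ∈ Icc 1 m :=
    hg.subset_tools e (by simp; omega) (hg.subset e (by simp; omega) htT)
  have hseen : σ.arr .lastSeen t = if prev T t e = 0 then -1 else (prev T t e : ℤ) := by
    rw [hσ.seen t htm, if_neg hD]
  have hupd : ∀ σ₁ : State Reg Arr, σ₁.arr .lastSeen = σ.arr .lastSeen → ∀ u ∈ Icc 1 m,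
      Function.update (σ₁.arr .lastSeen) t e (u : ℕ) = if u ∈ insert t D then (e : ℤ) else
        if prev T u e = 0 then -1 else (prev T u e : ℤ) := by
    intro σ₁ h₁ u hu
    rw [h₁, Function.update_apply]
    simp only [Nat.cast_inj, mem_insert, hσ.seen u hu]
    by_cases hut : u = t <;> simp [hut]
  have hpos := hσ.pos
  have hlf := hσ.lastFull
  have hpc := hσ.pipesCount
  refine Runs.block_cons (Runs.assign (Runs.block_cons (Runs.assign (Runs.block_cons
    (Runs.when (fun hc => ?_) fun hc => ?_)))))
  · simp only [Cond.Holds, Expr.eval_reg, Expr.eval_cell, State.setReg_reg, State.setReg_arr,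
      reduceCtorEq, if_false, if_true, hpos, ht, hlf, hseen] at hc
    have hp : prev T t e ≠ 0 := by
      intro h0
      rw [if_pos h0] at hc
      omega
    rw [if_neg hp] at hc
    have hf : f ≤ prev T t e := by exact_mod_cast hc
    refine Runs.block_cons (Runs.assign (Runs.block_cons (Runs.mono (runs_pipe (t := t)
      (pos := pos + 1) hg
      ⟨hσ.input.congr (by simp) (by simp) (by simp) (by simp) (by simp),
        hσ.stored.congr (by simp) (by simp) (by simp), by simpa using hσ.seen, by simp [hlf],
        by simp [hpc], by simp [hσ.total], by simp [hpos]⟩ hn htm hD (by simp [he])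
        (by simp [hpos, ht]) hp hf) ?_)))
    rintro k₁ σ₁ ⟨hk, hr, hpc₁, ha, hst, f', hf', hfe, hfull, hnot⟩
    refine Runs.block_nil (Runs.block_cons (Runs.store (Runs.block_nil ?_)))
    have ht₁ : σ₁.reg .t = t := by simp [hr, hpos, ht]
    have he₁ : σ₁.reg .e = e := by simp [hr, he]
    refine ⟨by simp [he₁], by simp [hr], by simp [ha], pipe M t (prev T t e) e, f', cnt + 1,
      hg.accept hn htT hD hp hf hfe hfull hnot,
      ⟨hσ.input.congr (by simp [hr]) (by simp [hr]) (by simp [hr]) (by simp [ha]) (by simp [ha]),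
        hst.congr (by simp) (by simp) (by simp), ?_, by simp [hf'], by simp [hpc₁, hpc],
        by simp [hr, hσ.total], by simp [hr, hpos]⟩, ?_⟩
    · simpa [ht₁, he₁] using hupd σ₁ (by simp [ha])
    -- The 60 units per job of the pipe are covered by the growth of the potential; only a constant
    -- remains per tool.
    · have hsum := sum_card_add_le_pipe (n := n) (e := e) (t := t) (M := M) (s := prev T t e)
        (by omega) (by omega) (fun i => hg.fresh t i hD)
      simp [Cond.cost]
      omega
  · simp only [Cond.Holds, Expr.eval_reg, Expr.eval_cell, State.setReg_reg, State.setReg_arr,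
      reduceCtorEq, if_false, if_true, hpos, ht, hlf, hseen] at hc
    have hp : prev T t e = 0 ∨ prev T t e < f := by
      by_cases h0 : prev T t e = 0
      · exact Or.inl h0
      · rw [if_neg h0] at hc
        right
        omega
    refine Runs.block_cons (Runs.store (Runs.block_nil ?_))
    refine ⟨by simp [he], by simp, by simp, M, f, cnt, hg.reject hn htT hD hp,
      ⟨hσ.input.congr (by simp) (by simp) (by simp) (by simp) (by simp),
        hσ.stored.congr (by simp) (by simp) (by simp), ?_, by simp [hlf], by simp [hpc],
        by simp [hσ.total], by simp [hpos]⟩, ?_⟩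
    · simpa [hpos, ht, he] using hupd σ rfl
    · simp [Cond.cost]
      omega

/-- Considering all pipes that end at job `e`. -/
theorem runs_job (hg : GreedyInv n m C T e ∅ M f cnt)
    (hσ : GpcaState n m C T e ∅ M f cnt (∑ i ∈ Ico 1 e, (#(T i) : ℤ)) σ) (hn : e ≤ n)
    (he : σ.reg .e = e) :
    Runs (block [
      forUp .k 0 (.cell .len (v .e) - 1) (block [
        .assign .t (.cell .inp (v .p)),
        .assign .p (v .p + 1),
        when (.le (v .lastFull) (.cell .lastSeen (v .t))) (block [
          .assign .pipesCount (v .pipesCount + 1),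
          forUp .i (.cell .lastSeen (v .t) + 1) (v .e - 1) (block [
            append .i,
            when (.eq (.cell .card (v .i)) (v .C)) (.assign .lastFull (v .i))])]),
        .store .lastSeen (v .t) (v .e)]),
      when (.eq (.cell .card (v .e)) (v .C)) (.assign .lastFull (v .e))]) σ fun k σ' =>
      σ'.reg .e = e ∧
      ∃ M' f' cnt', GreedyInv n m C T (e + 1) ∅ M' f' cnt' ∧
        GpcaState n m C T (e + 1) ∅ M' f' cnt' (∑ i ∈ Ico 1 (e + 1), (#(T i) : ℤ)) σ' ∧
        k + 60 * ∑ i ∈ Icc 1 n, #(M i) ≤ 60 * ∑ i ∈ Icc 1 n, #(M' i) + 100 * #(T e) + 40 := by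
  have he2 := hg.two_le
  have hen : e ∈ Icc 1 n := by simp; omega
  obtain ⟨g, hgl, hginj, hgT⟩ := lists_iff.1 (hσ.input.inp e hen)
  refine Runs.block_cons (Runs.mono (Runs.forUp (fun z k σ' =>
      σ'.reg .e = e ∧ σ'.arr .inp = σ.arr .inp ∧
      ∃ M' f' cnt', GreedyInv n m C T e ((range z).image g) M' f' cnt' ∧
        GpcaState n m C T e ((range z).image g) M' f' cnt' (∑ i ∈ Ico 1 e, (#(T i) : ℤ) + z) σ' ∧
        k + 60 * ∑ i ∈ Icc 1 n, #(M i) ≤ 60 * ∑ i ∈ Icc 1 n, #(M' i) + 100 * z + 2)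
      (a := 0) (b := #(T e)) (by simp) (by omega) ⟨by simp [he], by simp, M, f, cnt,
        by simpa using hg, ?_, by simp; omega⟩ ?_ ?_) ?_)
  · exact ⟨hσ.input.congr (by simp) (by simp) (by simp) (by simp) (by simp),
        hσ.stored.congr (by simp) (by simp) (by simp), by simpa using hσ.seen,
        by simp [hσ.lastFull], by simp [hσ.pipesCount], by simp [hσ.total], by simp [hσ.pos]⟩
  · rintro z k σ' ⟨he', -, M', f', cnt', -, hσ', -⟩ -
    simp [he', hσ'.input.len e hen]
  · rintro z k σ' - hz ⟨he', hinp, M', f', cnt', hg', hσ', hk⟩ hkz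
    -- The listing has no repetitions, so the next tool has not been treated at this job.
    have hgz : g z ∉ (range z).image g := by
      intro hmem
      obtain ⟨y, hy, hyz⟩ := mem_image.1 hmem
      have hy := mem_range.1 hy
      have := hginj (by simp; omega) (by simp; omega) hyz
      omega
    have hgze : g z ∈ T e := by
      rw [← hgT]
      exact mem_image_of_mem _ (mem_range.2 hz)
    refine Runs.mono (runs_tool hg' hσ' hn hgze hgz he' (by rw [hinp]; exact hgl z hz)) ?_
    rintro k₁ σ₁ ⟨he₁, hk₁, hinp₁, M₁, f₁, cnt₁, hg₁, hσ₁, hk'⟩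
    rw [← image_insert, ← range_add_one] at hg₁ hσ₁
    refine ⟨by rw [hk₁, hkz], by simp [he₁], by simp [hinp₁, hinp], M₁, f₁, cnt₁, hg₁,
      ⟨hσ₁.input.congr (by simp) (by simp) (by simp) (by simp) (by simp),
        hσ₁.stored.congr (by simp) (by simp) (by simp), by simpa using hσ₁.seen,
        by simp [hσ₁.lastFull], by simp [hσ₁.pipesCount], by simp [hσ₁.total], ?_⟩, ?_⟩
    · simp [hσ₁.pos]
      ring
    · simp
      omega
  · rintro k σ₁ ⟨k₀, rfl, -, he₁, -, M₁, f₁, cnt₁, hg₁, hσ₁, hk⟩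
    rw [hgT] at hg₁ hσ₁
    have hcard : σ₁.arr .card e = #(M₁ e) := (hσ₁.stored e hen).2.1
    have hfin := hg₁.finish hn
    have hseen : ∀ t ∈ Icc 1 m, σ₁.arr .lastSeen (t : ℕ) =
        if t ∈ (∅ : Finset ℕ) then ((e + 1 : ℕ) : ℤ) else
          if prev T t (e + 1) = 0 then -1 else (prev T t (e + 1) : ℤ) := by
      intro t ht
      rw [hσ₁.seen t ht, if_neg (notMem_empty t)]
      by_cases hte : t ∈ T e
      · rw [if_pos hte, prev_succ_of_mem hte, if_neg (by omega)]
      · rw [if_neg hte, prev_succ_of_notMem hte]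
    have hpos : ∑ i ∈ Ico 1 e, (#(T i) : ℤ) + #(T e) = ∑ i ∈ Ico 1 (e + 1), (#(T i) : ℤ) := by
      rw [sum_Ico_succ_top (by omega)]
    refine Runs.block_cons (Runs.when (fun hc => Runs.assign (Runs.block_nil ?_))
      fun hc => Runs.block_nil ?_)
    · simp only [Cond.Holds, Expr.eval_cell, Expr.eval_reg, he₁, hcard, hσ₁.input.reg_C,
        Nat.cast_inj] at hc
      rw [if_pos hc] at hfin
      refine ⟨by simp [he₁], M₁, e, cnt₁, hfin,
        ⟨hσ₁.input.congr (by simp) (by simp) (by simp) (by simp) (by simp),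
          hσ₁.stored.congr (by simp) (by simp) (by simp), by simpa using hseen,
          by simp [he₁], by simp [hσ₁.pipesCount], by simp [hσ₁.total], by simp [hσ₁.pos, hpos]⟩, ?_⟩
      simp [Cond.cost]
      omega
    · simp only [Cond.Holds, Expr.eval_cell, Expr.eval_reg, he₁, hcard, hσ₁.input.reg_C,
        Nat.cast_inj] at hc
      rw [if_neg hc] at hfin
      refine ⟨by simp [he₁], M₁, f₁, cnt₁, hfin,
        ⟨hσ₁.input, hσ₁.stored, hseen, hσ₁.lastFull, hσ₁.pipesCount, hσ₁.total,
          by simp [hσ₁.pos, hpos]⟩, ?_⟩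
      simp [Cond.cost]
      omega

/-- The program `gpca` computes the greedy pipe construction and halts in time `O(C * n)`. -/
theorem runs_gpca (hT : IsInstance n m C T) (h : IsInput n m C T σ) :
    Runs gpca σ fun k σ' => k ≤ 2000 * (C * n) ∧ ∃ M f cnt,
      GreedyInv n m C T (n + 1) ∅ M f cnt ∧ IsInput n m C T σ' ∧ Stored C n M σ' ∧
      σ'.reg .value = ∑ i ∈ Icc 1 n, (#(T i) : ℤ) - C - cnt := by
  have hn := hT.one_le_n
  have hC := hT.one_le_C
  have h1 : 1 ∈ Icc 1 n := by simp; omega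
  have hCn : n ≤ C * n := Nat.le_mul_of_pos_left n hC
  have hsum := hT.sum_card_le
  have hm := hT.le_sum_card
  have hT1 : #(T 1) ≤ ∑ i ∈ Icc 1 n, #(T i) := single_le_sum (f := fun i => #(T i)) (by simp) h1
  obtain ⟨g, hgl, -, hgT⟩ := lists_iff.1 (h.inp 1 h1)
  simp only [Ico_self, sum_empty, zero_add] at hgl
  have hlen := h.len 1 h1
  refine Runs.block_cons (Runs.assign (Runs.block_cons (Runs.assign (Runs.block_cons (Runs.mono
    (runs_fill (m := m) .lastSeen (-1) (by simp [h.reg_m])) ?_)))))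
  rintro k₁ σ₁ ⟨hk₁, hr₁, ha₁, hs₁⟩
  refine Runs.block_cons (Runs.mono (runs_mark (S := T 1) (f := g) .lastSeen 1 hgT ?_) ?_)
  · intro σ' hr ha
    refine ⟨?_, fun k hk hkr => ?_⟩
    · have : σ'.arr .len 1 = #(T 1) := by
        rw [ha .len (by simp), ha₁ .len (by simp)]
        simpa using hlen
      simp [this]
    · simp [hkr, ha, ha₁, hgl k hk]
  rintro k₂ σ₂ ⟨hk₂, hr₂, ha₂, hs₂⟩
  refine Runs.block_cons (Runs.assign (Runs.block_cons (Runs.assign (Runs.block_cons (Runs.assign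
    (Runs.block_cons (Runs.mono (runs_init (n := n) (m := m) (C := C) (T := T) ?_ hT.card_le
      (by simp) (by simp) (by simp)) ?_)))))))
  · exact h.congr (by simp [hr₁, hr₂]) (by simp [hr₁, hr₂]) (by simp [hr₁, hr₂])
      (by simp [ha₁, ha₂]) (by simp [ha₁, ha₂])
  rintro k₃ σ₃ ⟨hk₃, h₃, hst₃, htot₃, hpc₃, hlf₃, hls₃⟩
  have hlen₃ : σ₃.arr .len 1 = #(T 1) := by simpa using h₃.len 1 h1
  refine Runs.block_cons (Runs.assign (Runs.block_cons (Runs.mono (Runs.forUp (fun e k σ' =>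
      ∃ M' f' cnt', GreedyInv n m C T e ∅ M' f' cnt' ∧
        GpcaState n m C T e ∅ M' f' cnt' (∑ i ∈ Ico 1 e, (#(T i) : ℤ)) σ' ∧
        k + 60 * ∑ i ∈ Icc 1 n, #(T i) ≤
          60 * ∑ i ∈ Icc 1 n, #(M' i) + 100 * ∑ i ∈ Ico 1 e, #(T i) + 60 * e) (a := 2) (b := n + 1)
      (by simp) (by omega) ⟨T, 0, 0, GreedyInv.init hT hn,
        ⟨h₃.congr (by simp) (by simp) (by simp) (by simp) (by simp),
        hst₃.congr (by simp) (by simp) (by simp), ?_, ?_, ?_, by simp [htot₃], ?_⟩, ?_⟩ ?_ ?_) ?_)))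
  · intro t ht
    have h₁ : σ₃.arr .lastSeen t = if t ∈ T 1 then 1 else -1 := by
      rw [hls₃]
      simp [hs₂, hs₁ t ht]
    by_cases ht1 : t ∈ T 1
    · simp [h₁, ht1, prev]
    -- The irrelevant set `T 0` does no harm: `prev` is 0 in either case.
    · by_cases ht0 : t ∈ T 0 <;> simp [h₁, ht1, ht0, prev]
  · simp [hlf₃, hr₂, hr₁]
  · simp [hpc₃, hr₂, hr₁]
  · simp [hlen₃]
  · simp
    omega
  · rintro e k σ' ⟨M', f', cnt', -, hσ', -⟩ -
    simp [hσ'.input.reg_n]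
  · rintro e k σ' he hen ⟨M', f', cnt', hg', hσ', hk⟩ he'
    refine Runs.mono (runs_job hg' hσ' (by omega) he') ?_
    rintro k₄ σ₄ ⟨he₄, M₄, f₄, cnt₄, hg₄, hσ₄, hk₄⟩
    refine ⟨he₄, M₄, f₄, cnt₄, hg₄,
      ⟨hσ₄.input.congr (by simp) (by simp) (by simp) (by simp) (by simp),
        hσ₄.stored.congr (by simp) (by simp) (by simp), by simpa using hσ₄.seen,
        by simp [hσ₄.lastFull], by simp [hσ₄.pipesCount], by simp [hσ₄.total],
        by simp [hσ₄.pos]⟩, ?_⟩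
    rw [sum_Ico_succ_top (by omega)]
    simp
    omega
  · rintro k₄ σ₄ ⟨k₅, rfl, -, M₄, f₄, cnt₄, hg₄, hσ₄, hk₄⟩
    refine Runs.block_cons (Runs.assign (Runs.block_nil ⟨?_, M₄, f₄, cnt₄, hg₄,
      hσ₄.input.congr (by simp) (by simp) (by simp) (by simp) (by simp),
      hσ₄.stored.congr (by simp) (by simp) (by simp), ?_⟩))
    -- The final potential bounds the total time for pipes.
    · have hsumM : ∑ i ∈ Icc 1 n, #(M₄ i) ≤ C * n := by
        have := sum_le_card_nsmul _ _ _ hg₄.card_le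
        simpa [Nat.mul_comm] using this
      rw [Ico_add_one_right_eq_Icc] at hk₄
      simp at hk₂ ⊢
      omega
    · simp [hσ₄.total, hσ₄.pipesCount, hσ₄.input.reg_C]

end Gpca

/-! ### Correctness and running time of ToFullMag. -/

section ToFullMag

variable {n m C L : ℕ} {T M : ℕ → Finset ℕ} {σ : State Reg Arr}

/-- One step of ToFullMag. -/
theorem runs_fillFrom {i j : ℕ} (h : Stored C n M σ) (hCr : σ.reg .C = C)
    (hused : ∀ t ∈ Icc 1 m, σ.arr .used (t : ℕ) = 0) (hM : ∀ l ∈ Icc 1 n, M l ⊆ Icc 1 m)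
    (hC : ∀ l ∈ Icc 1 n, #(M l) ≤ C) (hri : σ.reg .i = i) (hrj : σ.reg .j = j)
    (hi : i ∈ Icc 1 n) (hj : j ∈ Icc 1 n) (hij : i ≠ j) :
    Runs fillFrom σ fun k σ' => k ≤ 200 * C + 200 ∧
      (∀ r, r ≠ .k → r ≠ .t → σ'.reg r = σ.reg r) ∧
      (∀ t ∈ Icc 1 m, σ'.arr .used (t : ℕ) = 0) ∧
      ∃ A, Stored C n (Function.update M j A) σ' ∧ M j ⊆ A ∧ A ⊆ M j ∪ M i ∧ #A ≤ C ∧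
        (#A = C ∨ M i ⊆ A) := by
  obtain ⟨hbj, hcj, hlj⟩ := h j hj
  obtain ⟨hbi, hci, hli⟩ := h i hi
  obtain ⟨f, hf, -, hfM⟩ := lists_iff.1 hlj
  obtain ⟨g, hg, hginj, hgM⟩ := lists_iff.1 hli
  have hCi := hC i hi
  have hCj := hC j hj
  refine Runs.block_cons (Runs.mono (runs_mark (S := M j) (f := f) .used 1 hfM ?_) ?_)
  · intro σ' hr ha
    refine ⟨by simp [hr, ha, hrj, hcj], fun k hk hkr => ?_⟩
    simp [hr, ha, hrj, hbj, hkr, hf k hk]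
  rintro k₁ σ₁ ⟨hk₁, hr₁, ha₁, hu₁⟩
  refine Runs.block_cons (Runs.mono (Runs.forUp (fun z k σ' => k ≤ 100 * z + 2 ∧
      (∀ r, r ≠ .k → r ≠ .t → σ'.reg r = σ.reg r) ∧
      (∀ a, a ≠ .mag → a ≠ .card → σ'.arr a = σ₁.arr a) ∧
      (∀ k : ℕ, k < C → σ'.arr .mag (((i : ℤ) - 1) * C + k) =
        σ.arr .mag (((i : ℤ) - 1) * C + k)) ∧
      ∃ A, Stored C n (Function.update M j A) σ' ∧ M j ⊆ A ∧ A ⊆ M j ∪ (range z).image g ∧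
        #A ≤ C ∧ (#A = C ∨ (range z).image g ⊆ A)) (a := 0) (b := #(M i)) (by simp) (by omega)
      ⟨by simp, fun r h₁ h₂ => by simp [h₁, hr₁], by simp, by simp [ha₁], M j, ?_, Subset.rfl,
        by simp, hCj, by simp⟩ ?_ ?_) ?_)
  · rw [Function.update_eq_self]
    exact h.congr (by simp [ha₁]) (by simp [ha₁]) (by simp [ha₁])
  · rintro z k σ' ⟨-, hr, -, -, A, hst, -⟩ -
    have := (hst i hi).2.1
    rw [Function.update_of_ne hij] at this
    simp [hr, hri, this]
  · rintro z k σ' - hz ⟨hk, hr, ha, hmag, A, hst, hjA, hAj, hAC, hA⟩ hkz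
    have hgz : g z ∉ (range z).image g := by
      intro hmem
      obtain ⟨y, hy, hyz⟩ := mem_image.1 hmem
      have hy := mem_range.1 hy
      have := hginj (by simp; omega) (by simp; omega) hyz
      omega
    have hgi : g z ∈ M i := hgM.subset (mem_image_of_mem _ (mem_range.2 hz))
    have hbase : σ'.arr .base i = ((i : ℤ) - 1) * C := (hst i hi).1
    have hcard : σ'.arr .card j = #A := by
      simpa using (hst j hj).2.1
    have hused' : σ'.arr .used (g z) = if g z ∈ M j then 1 else 0 := by
      rw [ha _ (by simp) (by simp), hu₁, hused _ (hM i hi hgi)]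
    have hread : σ'.arr .mag (((i : ℤ) - 1) * C + z) = g z := by
      rw [hmag z (by omega), hg z hz]
    have hAj' : A ⊆ M j ∪ (range (z + 1)).image g :=
      hAj.trans (union_subset_union Subset.rfl (image_subset_image (range_subset_range.2 (by omega))))
    refine Runs.block_cons (Runs.assign (Runs.block_cons (Runs.when (fun hc => Runs.when
      (fun hlt => ?_) fun hlt => Runs.block_nil ?_) fun hc => Runs.block_nil ?_)))
    · simp only [Cond.Holds, Expr.eval_add, Expr.eval_cell, Expr.eval_reg, State.setReg_reg,
        State.setReg_arr, reduceCtorEq, if_false, if_true, hr, ne_eq, not_false_eq_true, hri, hrj,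
        hbase, hkz, hread, hused', hcard, hCr, Expr.eval_zero, Nat.cast_lt] at hc hlt
      have hgj : g z ∉ M j := by
        intro hgj
        simp [hgj] at hc
      -- The marks only record the original `M j`; a tool added in this step is not met again,
      -- because `M i` is listed without repetitions.
      have hgA : g z ∉ A := by
        intro hgA
        rcases mem_union.1 (hAj hgA) with h' | h'
        · exact hgj h'
        · exact hgz h'
      refine Runs.mono (runs_append (i := j) (t := g z) (M := Function.update M j A) (C := C)
        (N := n) (hst.congr (by simp) (by simp) (by simp)) (by simp [hr, hrj]) hj
        (by simp [hr, hri, hbase, hkz, hread]) (by simpa using hgA) (fun l hl => ?_)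
        (by simpa using hlt)) ?_
      · rcases eq_or_ne l j with rfl | hlj
        · simpa using hAC
        · simpa [Function.update_of_ne hlj] using hC l hl
      rintro k₂ σ₂ ⟨hk₂, hr₂, ha₂, hst₂, hmag₂⟩
      rw [Function.update_self, Function.update_idem] at hst₂
      refine Runs.block_nil ⟨by simp [hr₂, hkz], by simp [Cond.cost]; omega,
        fun r h₁ h₂ => by simp [h₁, h₂, hr₂, hr], fun a h₁ h₂ => by simp [h₁, h₂, ha₂, ha],
        fun l hl => ?_, insert (g z) A, hst₂.congr (by simp) (by simp) (by simp),
        hjA.trans (subset_insert _ _), ?_, ?_, ?_⟩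
      · simp only [State.setReg_arr]
        rw [hmag₂ i l hij hl, ← hmag l hl, State.setReg_arr]
      · refine insert_subset (mem_union_right _ (mem_image_of_mem _ (by simp))) hAj'
      · rw [card_insert_of_notMem hgA]
        omega
      · rcases hA with hA | hA
        · omega
        · right
          rw [range_add_one, image_insert]
          exact insert_subset_insert _ hA
    · simp only [Cond.Holds, Expr.eval_add, Expr.eval_cell, Expr.eval_reg, State.setReg_reg,
        State.setReg_arr, reduceCtorEq, if_false, if_true, hr, ne_eq, not_false_eq_true, hri, hrj,
        hbase, hkz, hread, hused', hcard, hCr, Expr.eval_zero, Nat.cast_lt] at hc hlt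
      exact ⟨by simp [hkz], by simp [Cond.cost]; omega,
        fun r h₁ h₂ => by simp [h₁, h₂, hr], fun a h₁ h₂ => by simp [ha _ h₁ h₂],
        fun l hl => by simp [hmag l hl], A, hst.congr (by simp) (by simp) (by simp), hjA,
        hAj', hAC, Or.inl (by omega)⟩
    · simp only [Cond.Holds, Expr.eval_add, Expr.eval_cell, Expr.eval_reg, State.setReg_reg,
        State.setReg_arr, reduceCtorEq, if_true, hr, ne_eq, not_false_eq_true, hri,
        hbase, hkz, hread, hused', Expr.eval_zero] at hc
      refine ⟨by simp [hkz], by simp [Cond.cost]; omega,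
        fun r h₁ h₂ => by simp [h₁, h₂, hr], fun a h₁ h₂ => by simp [ha _ h₁ h₂],
        fun l hl => by simp [hmag l hl], A, hst.congr (by simp) (by simp) (by simp), hjA,
        hAj', hAC, hA.imp id fun hA => ?_⟩
      have hgj : g z ∈ M j := by
        by_contra hgj
        simp [hgj] at hc
      rw [range_add_one, image_insert]
      exact insert_subset (hjA hgj) hA
  rintro k₂ σ₂ ⟨k₀, rfl, -, hk₂, hr₂, ha₂, -, A, hst₂, hjA, hAj, hAC, hA⟩
  rw [hgM] at hAj hA
  obtain ⟨hbj', hcj', hlj'⟩ := hst₂ j hj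
  rw [Function.update_self] at hcj' hlj'
  obtain ⟨f', hf', -, hfA⟩ := lists_iff.1 hlj'
  have hAm : A ⊆ Icc 1 m := hAj.trans (union_subset (hM j hj) (hM i hi))
  -- Clearing along `A`, which contains `M j`, removes every mark.
  refine Runs.block_cons (Runs.mono (runs_mark (S := A) (f := f') .used 0 hfA ?_) ?_)
  · intro σ' hr ha
    refine ⟨by simp [hr, ha, hr₂, hrj, hcj'], fun k hk hkr => ?_⟩
    simp [hr, ha, hr₂, hrj, hbj', hkr, hf' k hk]
  rintro k₃ σ₃ ⟨hk₃, hr₃, ha₃, hu₃⟩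
  refine Runs.block_nil ⟨?_, fun r h₁ h₂ => by rw [hr₃ r h₁, hr₂ r h₁ h₂], fun t ht => ?_, A,
    hst₂.congr (by simp [ha₃]) (by simp [ha₃]) (by simp [ha₃]), hjA, hAj, hAC, hA⟩
  · simp at hk₁ hk₂ hk₃ ⊢
    omega
  · rw [hu₃]
    split_ifs with htA
    · rfl
    · rw [ha₂ _ (by simp) (by simp), hu₁, if_neg (fun htj => htA (hjA htj)), hused t ht]

/-- Magazine states that may have empty slots, with at most `L` loads. -/
structure Partial (n m C : ℕ) (T : ℕ → Finset ℕ) (L : ℕ) (M : ℕ → Finset ℕ) : Prop where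
  subset : ∀ i ∈ Icc 1 n, T i ⊆ M i
  subset_tools : ∀ i ∈ Icc 1 n, M i ⊆ Icc 1 m
  card_le : ∀ i ∈ Icc 1 n, #(M i) ≤ C
  loads_le : loads n M ≤ L

theorem Partial.update (h : Partial n m C T L M) {i j : ℕ} {A : Finset ℕ} (hi : i ∈ Icc 1 n)
    (hj : j ∈ Icc 1 n) (hij : i + 1 = j ∨ i = j + 1) (h₁ : M j ⊆ A) (h₂ : A ⊆ M j ∪ M i)
    (hA : #A ≤ C) : Partial n m C T L (Function.update M j A) := by
  have hi' := mem_Icc.1 hi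
  have hj' := mem_Icc.1 hj
  refine ⟨fun l hl => ?_, fun l hl => ?_, fun l hl => ?_, ?_⟩
  · rcases eq_or_ne l j with rfl | hlj
    · rw [Function.update_self]
      exact (h.subset l hl).trans h₁
    · rw [Function.update_of_ne hlj]
      exact h.subset l hl
  · rcases eq_or_ne l j with rfl | hlj
    · rw [Function.update_self]
      exact h₂.trans (union_subset (h.subset_tools l hl) (h.subset_tools i hi))
    · rw [Function.update_of_ne hlj]
      exact h.subset_tools l hl
  · rcases eq_or_ne l j with rfl | hlj
    · rwa [Function.update_self]
    · rw [Function.update_of_ne hlj]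
      exact h.card_le l hl
  · refine le_trans ?_ h.loads_le
    rcases hij with hij | hij
    · obtain rfl : i = j - 1 := by omega
      exact loads_update_le_of_pred (by omega) h₁ h₂
    · subst hij
      exact loads_update_le_of_succ (by omega) (by omega) h₁ h₂

/-- The program `toFullMag` fills all magazine states without additional loads, in time
`O(C * n)`. -/
theorem runs_toFullMag (hT : IsInstance n m C T) (h : IsInput n m C T σ) (hst : Stored C n M σ)
    (hM : Partial n m C T L M) :
    Runs toFullMag σ fun k σ' => k ≤ 2000 * (C * n) ∧ σ'.reg .value = σ.reg .value ∧
      ∃ M', Stored C n M' σ' ∧ Partial n m C T L M' ∧ ∀ i ∈ Icc 1 n, #(M' i) = C := by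
  have hn := hT.one_le_n
  have hC := hT.one_le_C
  have hCn : n ≤ C * n := Nat.le_mul_of_pos_left n hC
  have hm := hT.le_sum_card.trans hT.sum_card_le
  refine Runs.block_cons (Runs.mono (runs_fill (m := m) .used 0 (by simp [h.reg_m])) ?_)
  rintro k₁ σ₁ ⟨hk₁, hr₁, ha₁, hu₁⟩
  refine Runs.block_cons (Runs.mono (Runs.forUp (fun z k σ' => k ≤ (200 * C + 230) * z ∧
      (∀ r, r ≠ .k → r ≠ .t → r ≠ .i → r ≠ .j → σ'.reg r = σ.reg r) ∧
      (∀ t ∈ Icc 1 m, σ'.arr .used (t : ℕ) = 0) ∧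
      ∃ M', Stored C n M' σ' ∧ Partial n m C T L M' ∧
        ∀ i, 1 ≤ i → i + 1 < z → #(M' (i + 1)) = C ∨ M' i ⊆ M' (i + 1)) (a := 2) (b := n + 1)
      (by simp) (by omega) ⟨by simp, fun r h₁ h₂ h₃ h₄ => by simp [h₂, h₄, hr₁],
        by simpa using hu₁, M, hst.congr (by simp [ha₁]) (by simp [ha₁]) (by simp [ha₁]), hM,
        by omega⟩ ?_ ?_) ?_)
  · rintro z k σ' ⟨-, hr, -⟩ -
    simp [hr, h.reg_n]
  · rintro z k σ' hz hzn ⟨hk, hr, hu, M', hst', hM', hfull⟩ hj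
    obtain ⟨z, rfl⟩ : ∃ y, z = y + 1 := ⟨z - 1, by omega⟩
    have hz1 : z ∈ Icc 1 n := by simp; omega
    have hz2 : z + 1 ∈ Icc 1 n := by simp; omega
    refine Runs.block_cons (Runs.assign (Runs.block_cons (Runs.mono (runs_fillFrom (m := m)
      (i := z) (j := z + 1) (hst'.congr (by simp) (by simp) (by simp)) (by simp [hr, h.reg_C])
      (by simpa using hu) hM'.subset_tools hM'.card_le (by simp [hj]) (by simp [hj])
      hz1 hz2 (by omega)) ?_)))
    rintro k₂ σ₂ ⟨hk₂, hr₂, hu₂, A, hst₂, hA₁, hA₂, hA₃, hA₄⟩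
    refine Runs.block_nil ⟨by simp [hr₂, hj], ?_, fun r h₁ h₂ h₃ h₄ => by
      simp [h₁, h₂, h₃, h₄, hr₂, hr], by simpa using hu₂, _,
      hst₂.congr (by simp) (by simp) (by simp),
      hM'.update hz1 hz2 (Or.inl rfl) hA₁ hA₂ hA₃, fun i hi hiz => ?_⟩
    · rw [Nat.mul_succ]
      simp
      omega
    -- Only state `z + 1` has changed, so earlier pairs are unaffected and `hA₄` settles the new
    -- pair.
    · rw [Function.update_of_ne (by omega : i ≠ z + 1)]
      rcases eq_or_ne i z with rfl | hiz'
      · rwa [Function.update_self]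
      · rw [Function.update_of_ne (by omega : i + 1 ≠ z + 1)]
        exact hfull i hi (by omega)
  rintro k₂ σ₂ ⟨k₀, rfl, -, hk₂, hr₂, hu₂, M₂, hst₂, hM₂, hfull₂⟩
  have hlast : #(M₂ n) = C := card_last_of_forall hT hn hM₂.subset hM₂.card_le fun i hi => by
    have := mem_Ico.1 hi
    exact hfull₂ i (by omega) (by omega)
  refine Runs.block_cons (Runs.mono (Runs.forDown (fun z k σ' =>
      k + (200 * C + 230) * z ≤ (200 * C + 230) * n ∧
      (∀ r, r ≠ .k → r ≠ .t → r ≠ .i → r ≠ .j → σ'.reg r = σ.reg r) ∧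
      (∀ t ∈ Icc 1 m, σ'.arr .used (t : ℕ) = 0) ∧
      ∃ M', Stored C n M' σ' ∧ Partial n m C T L M' ∧ ∀ i, z < i → i ≤ n → #(M' i) = C)
      (b := n - 1) ?_ ⟨?_, fun r h₁ h₂ h₃ h₄ => by simp [h₄, hr₂ r h₁ h₂ h₃ h₄],
        by simpa using hu₂, M₂, hst₂.congr (by simp) (by simp) (by simp), hM₂, fun i h₁ h₂ => ?_⟩
      ?_ ?_) ?_)
  · simp [hr₂, h.reg_n]
    omega
  · obtain ⟨n, rfl⟩ : ∃ y, n = y + 1 := ⟨n - 1, by omega⟩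
    simp [Nat.mul_succ]
    omega
  · obtain rfl : i = n := by omega
    exact hlast
  · simp
  · rintro z k σ' hz ⟨hk, hr, hu, M', hst', hM', hfull⟩ hj
    have hz1 : z + 1 ∈ Icc 1 n := by simp; omega
    have hz2 : z + 2 ∈ Icc 1 n := by simp; omega
    refine Runs.block_cons (Runs.assign (Runs.block_cons (Runs.mono (runs_fillFrom (m := m)
      (i := z + 2) (j := z + 1) (hst'.congr (by simp) (by simp) (by simp)) (by simp [hr, h.reg_C])
      (by simpa using hu) hM'.subset_tools hM'.card_le (by simp [hj]; ring) (by simp [hj])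
      hz2 hz1 (by omega)) ?_)))
    rintro k₃ σ₃ ⟨hk₃, hr₃, hu₃, A, hst₃, hA₁, hA₂, hA₃, hA₄⟩
    refine Runs.block_nil ⟨by simp [hr₃, hj], ?_, fun r h₁ h₂ h₃ h₄ => by
      simp [h₁, h₂, h₃, h₄, hr₃, hr], by simpa using hu₃, _,
      hst₃.congr (by simp) (by simp) (by simp),
      hM'.update hz2 hz1 (Or.inr rfl) hA₁ hA₂ hA₃, fun i h₁ h₂ => ?_⟩
    · rw [Nat.mul_succ] at hk
      simp
      omega
    · rcases eq_or_ne i (z + 1) with rfl | hiz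
      · rw [Function.update_self]
        rcases hA₄ with hA₄ | hA₄
        · exact hA₄
        -- The following state is already full, so containing it forces `C` tools.
        · have := card_le_card hA₄
          rw [hfull (z + 2) (by omega) (by omega)] at this
          omega
      · rw [Function.update_of_ne hiz]
        exact hfull i (by omega) h₂
  · rintro k₃ σ₃ ⟨k₄, rfl, hk₃, hr₃, -, M₃, hst₃, hM₃, hfull₃⟩
    refine Runs.block_nil ⟨?_, hr₃ _ (by simp) (by simp) (by simp) (by simp), M₃, hst₃, hM₃,
      fun i hi => hfull₃ i (by simp at hi; omega) (by simp at hi; omega)⟩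
    have h₁ : (200 * C + 230) * n = 200 * (C * n) + 230 * n := by ring
    have h₂ : (200 * C + 230) * (n + 1) = 200 * (C * n) + 230 * n + 200 * C + 230 := by ring
    have h₃ : C ≤ C * n := Nat.le_mul_of_pos_right C hn
    simp at hk₃ ⊢
    omega

end ToFullMag

end TLP

/-! ### The lower and upper bounds meet. -/

theorem theorem3 :
    ∃ K : ℕ, ∀ (n m C : ℕ) (T : ℕ → Finset ℕ), TLP.IsInstance n m C T →
      ∀ σ : TLP.State TLP.Reg TLP.Arr, TLP.IsInput n m C T σ →
        ∃ (k : ℕ) (σ' : TLP.State TLP.Reg TLP.Arr) (z : ℕ) (M : ℕ → Finset ℕ),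
          TLP.Exec (.seq TLP.gpca TLP.toFullMag) σ k σ' ∧
          k ≤ K * (C * n) ∧
          TLP.IsOutput n C z M σ' ∧
          IsLeast (TLP.switches n '' {M' | TLP.Feasible n m C T M'}) z ∧
          TLP.Optimal n m C T M := by
  refine ⟨4000, fun n m C T hT σ hσ => ?_⟩
  obtain ⟨k₁, σ₁, hx₁, hk₁, M₁, f, cnt, hg, hin, hst, hval⟩ := TLP.runs_gpca hT hσ
  obtain ⟨k₂, σ₂, hx₂, hk₂, hval₂, M, hstM, hM, hfull⟩ := TLP.runs_toFullMag hT hin hst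
    ⟨hg.subset, hg.subset_tools, hg.card_le, le_rfl⟩
  have hfeas : TLP.Feasible n m C T M :=
    fun i hi => ⟨hM.subset i hi, hM.subset_tools i hi, hfull i hi⟩
  have hloads := hM.loads_le
  have hupper := hg.card_add_switches_le
  have hlower : ∀ M', TLP.Feasible n m C T M' → _ := fun M' => hg.sum_card_le (M' := M')
  rw [TLP.loads, TLP.loads, hfull 1 (by have := hT.one_le_n; simp; omega)] at hloads
  -- The lower bound at `M` itself gives the equality that identifies the returned value with its
  -- number of switches.
  have hself := hlower M hfeas
  have hmin : ∀ M', TLP.Feasible n m C T M' → TLP.switches n M ≤ TLP.switches n M' := by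
    intro M' hM'
    have := hlower M' hM'
    omega
  refine ⟨k₁ + k₂, σ₂, TLP.switches n M, M, .seq hx₁ hx₂, by omega, ⟨?_, fun i hi =>
    (hstM i hi).2.2⟩, ⟨⟨M, hfeas, rfl⟩, ?_⟩, hfeas, fun M' hM' => hmin M' hM'⟩
  · have : ∑ i ∈ Finset.Icc 1 n, ((T i).card : ℤ) = C + TLP.switches n M + cnt := by
      have : ∑ i ∈ Finset.Icc 1 n, (T i).card = C + TLP.switches n M + cnt := by omega
      exact_mod_cast this
    rw [hval₂, hval, this]
    ring
  · rintro _ ⟨M', hM', rfl⟩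
    exact hmin M' hM'
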